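/- Let $d\in\{2,3\}$. Let $\Omega_1,\Omega_2\subset\mathbb R^d$ be disjoint bounded open sets whose boundaries are Lebesgue null sets (for instance Lipschitz), let $\Omega=(\overline{\Omega_1\cup\Omega_2})^\circ$ and $\Gamma=\partial\overline\Omega_1\cap\partial\overline\Omega_2$, and let $\boldsymbol n$ be the unit normal of $\Gamma$ pointing out of $\Omega_2$ into $\Omega_1$. Let $\mathcal T_0$ and $\mathcal T_2$ be finite conforming meshes of (closed, nondegenerate) simplices covering $\overline\Omega$ and $\overline\Omega_2$, respectively, that are shape regular with constant $\sigma>0$: every element $T$ satisfies $h_T\le\sigma\rho_T$, where $h_T$ is the diameter of $T$ and $\rho_T$ the diameter of the largest ball contained in $T$. Put $$\mathcal T_1^*=\{T\in\mathcal T_0: T\subset\overline\Omega_1\}\cup\{T\in\mathcal T_0: |T\cap\Omega_1|>0 \text{ and } |T\cap\Omega_2|>0\},\qquad \Omega_1^*=\bigcup_{T\in\mathcal T_1^*}T,\qquad \Omega_O=\Omega_2\cap\Omega_1^*.$$ For $k\ge 0$ let $V_h=V_{h,1}\oplus V_{h,2}$, where $V_{h,1}$ and $V_{h,2}$ are the spaces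 of continuous $\mathbb R^d$-valued vector fields on $\Omega_1^*$ and $\overline\Omega_2$ that are polynomial of degree at most $k$ on each element of $\mathcal T_1^*$ and of $\mathcal T_2$, respectively. For $\boldsymbol v_h=(\boldsymbol v_{h,1},\boldsymbol v_{h,2})\in V_h$ write $[\boldsymbol v_h]=\boldsymbol v_{h,2}-\boldsymbol v_{h,1}$ and $\langle\partial_{\boldsymbol n}\boldsymbol v_h\rangle=\partial_{\boldsymbol n}\boldsymbol v_{h,2}$ on $\Gamma$ (with the derivative of $\boldsymbol v_{h,2}$ taken from within the element of $\mathcal T_2$). Set $\|\boldsymbol w\|_{\alpha,h,\Gamma}^2=\sum_{T\in\mathcal T_2}h_T^{-2\alpha}\|\boldsymbol w\|_{L^2(\Gamma\cap T)}^2$ and, for $\gamma>0$, $$a_h(\boldsymbol u_h,\boldsymbol v_h)=\sum_{i=1}^2(\nabla\boldsymbol u_{h,i},\nabla\boldsymbol v_{h,i})_{\Omega_i}-(\langle\partial_{\boldsymbol n}\boldsymbol u_h\rangle,[\boldsymbol v_h])_\Gamma-(\langle\partial_{\boldsymbol n}\boldsymbol v_h\rangle,[\boldsymbol u_h])_\Gamma+\gamma\sum_{T\in\mathcal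 T_2}h_T^{-1}([\boldsymbol u_h],[\boldsymbol v_h])_{\Gamma\cap T},$$ $$s_h(\boldsymbol u_h,\boldsymbol v_h)=(\nabla(\boldsymbol u_{h,1}-\boldsymbol u_{h,2}),\nabla(\boldsymbol v_{h,1}-\boldsymbol v_{h,2}))_{\Omega_O},$$ $$|||\boldsymbol v_h|||_*^2=\sum_{T\in\mathcal T_1^*}\|\nabla\boldsymbol v_{h,1}\|_T^2+\sum_{T\in\mathcal T_2}\|\nabla\boldsymbol v_{h,2}\|_T^2+\|\langle\partial_{\boldsymbol n}\boldsymbol v_h\rangle\|_{-1/2,h,\Gamma}^2+\|[\boldsymbol v_h]\|_{1/2,h,\Gamma}^2.$$ Then there is $\gamma_0>0$, depending only on $d$, $k$ and $\sigma$, such that for every $\gamma\ge\gamma_0$ there are constants $c>0$ and $C>0$, depending only on $d,k,\sigma,\gamma,\Omega_1,\Omega_2$ (and not on the meshes or the mesh sizes), such that $$a_h(\boldsymbol u_h,\boldsymbol v_h)+s_h(\boldsymbol u_h,\boldsymbol v_h)\le C\,|||\boldsymbol u_h|||_*\,|||\boldsymbol v_h|||_*\qquad\text{for all }\boldsymbol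 u_h,\boldsymbol v_h\in V_h,$$ $$c\,|||\boldsymbol v_h|||_*^2\le a_h(\boldsymbol v_h,\boldsymbol v_h)+s_h(\boldsymbol v_h,\boldsymbol v_h)\qquad\text{for all }\boldsymbol v_h\in V_h.$$ -/

import Mathlib

open MeasureTheory

namespace OverlapNitsche

/-- The Euclidean space `ℝ^d`. -/
abbrev Space (d : ℕ) : Type := EuclideanSpace ℝ (Fin d)

/-- The closed simplex spanned by a finite set of vertices. -/
abbrev simplex {d : ℕ} (T : Finset (Space d)) : Set (Space d) :=
  convexHull ℝ (T : Set (Space d))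

/-- The diameter `h_T` of an element. -/
noncomputable def meshSize {d : ℕ} (T : Finset (Space d)) : ℝ :=
  Metric.diam (simplex T)

/-- The closed region covered by a finite family of simplices. -/
def region {d : ℕ} (cells : Finset (Finset (Space d))) : Set (Space d) :=
  ⋃ T ∈ cells, simplex T

/-- A finite conforming mesh of nondegenerate `d`-simplices in `ℝ^d`, each element being
given by its `d + 1` vertices. -/
structure SimplicialMesh (d : ℕ) where
  cells : Finset (Finset (Space d))
  card_eq : ∀ T ∈ cells, T.card = d + 1
  affineIndependent : ∀ T ∈ cells, AffineIndependent ℝ (fun p : T => (p : Space d))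
  inter_eq : ∀ S ∈ cells, ∀ T ∈ cells,
    simplex S ∩ simplex T = convexHull ℝ ((S : Set (Space d)) ∩ (T : Set (Space d)))

/-- Shape regularity `h_T / ρ_T ≤ σ` for every element, where `ρ_T` is the diameter of the
largest ball contained in `T`: each `T` contains a ball of diameter `h_T / σ`. -/
def SimplicialMesh.ShapeRegular {d : ℕ} (M : SimplicialMesh d) (σ : ℝ) : Prop :=
  ∀ T ∈ M.cells, ∃ x : Space d, Metric.closedBall x (meshSize T / (2 * σ)) ⊆ simplex T

/-- Two disjoint bounded open subdomains whose boundaries are Lebesgue null sets (as is the case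
for Lipschitz boundaries). -/
structure IsDecomposition {d : ℕ} (Ω₁ Ω₂ : Set (Space d)) : Prop where
  isOpen₁ : IsOpen Ω₁
  isOpen₂ : IsOpen Ω₂
  isBounded₁ : Bornology.IsBounded Ω₁
  isBounded₂ : Bornology.IsBounded Ω₂
  disjoint : Disjoint Ω₁ Ω₂
  null₁ : volume (frontier Ω₁) = 0
  null₂ : volume (frontier Ω₂) = 0

/-- The whole domain `Ω`, the interior of the closure of `Ω₁ ∪ Ω₂`. -/
def wholeDomain {d : ℕ} (Ω₁ Ω₂ : Set (Space d)) : Set (Space d) :=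
  interior (closure (Ω₁ ∪ Ω₂))

/-- The interface `Γ`. -/
def interface {d : ℕ} (Ω₁ Ω₂ : Set (Space d)) : Set (Space d) :=
  frontier (closure Ω₁) ∩ frontier (closure Ω₂)

/-- A background mesh `T₀` of `Ω` and an overlapping mesh `T₂` of `Ω₂`. -/
structure OverlappingMeshes {d : ℕ} (Ω₁ Ω₂ : Set (Space d)) where
  T₀ : SimplicialMesh d
  T₂ : SimplicialMesh d
  region_T₀ : region T₀.cells = closure (wholeDomain Ω₁ Ω₂)
  region_T₂ : region T₂.cells = closure Ω₂

/-- `n` is the outward unit normal of the set `S` at the point `x` of a flat part of its boundary: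
near `x`, the set `S` is the half space on the side of `x` opposite to `n`. -/
def IsOuterNormal {d : ℕ} (S : Set (Space d)) (x n : Space d) : Prop :=
  ‖n‖ = 1 ∧ ∃ r > 0, ∀ y ∈ Metric.ball x r, y ∈ S ↔ inner ℝ (y - x) n ≤ 0

open Classical in
/-- The outward unit normal of `S`. For a polyhedral region it exists at all boundary points
outside a set of zero surface measure; the value there is irrelevant and set to zero. -/
noncomputable def outerNormal {d : ℕ} (S : Set (Space d)) (x : Space d) : Space d :=
  if h : ∃ n, IsOuterNormal S x n then h.choose else 0

/-- Continuous `ℝ^d`-valued vector fields on the region covered by `cells` whose components are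
polynomials of degree at most `k` on each element. The fields are represented by functions on
`ℝ^d` whose values outside the region are arbitrary and never used. -/
def feSpace {d : ℕ} (cells : Finset (Finset (Space d))) (k : ℕ) :
    Submodule ℝ (Space d → Space d) where
  carrier := {v | ContinuousOn v (region cells) ∧
    ∀ T ∈ cells, ∀ i : Fin d, ∃ p : MvPolynomial (Fin d) ℝ, p.totalDegree ≤ k ∧
      ∀ x ∈ simplex T, v x i = MvPolynomial.eval (fun j => x j) p}
  zero_mem' := ⟨continuousOn_const, fun _ _ _ => ⟨0, by simp, fun _ _ => by simp⟩⟩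
  add_mem' := by
    rintro u v ⟨hu, hu'⟩ ⟨hv, hv'⟩
    refine ⟨hu.add hv, fun T hT i => ?_⟩
    obtain ⟨p, hp, hpe⟩ := hu' T hT i
    obtain ⟨q, hq, hqe⟩ := hv' T hT i
    refine ⟨p + q, (MvPolynomial.totalDegree_add p q).trans (max_le hp hq), fun x hx => ?_⟩
    simp [hpe x hx, hqe x hx]
  smul_mem' := by
    rintro c v ⟨hv, hv'⟩
    refine ⟨hv.const_smul c, fun T hT i => ?_⟩
    obtain ⟨p, hp, hpe⟩ := hv' T hT i
    refine ⟨c • p, (MvPolynomial.totalDegree_smul_le c p).trans hp, fun x hx => ?_⟩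
    simp [hpe x hx, MvPolynomial.smul_eval]

/-- Frobenius inner product `A : B` of two gradients. -/
noncomputable def gradInner {d : ℕ} (A B : Space d →L[ℝ] Space d) : ℝ :=
  ∑ j : Fin d, inner ℝ (A (EuclideanSpace.single j 1)) (B (EuclideanSpace.single j 1))

/-- `(∇u, ∇v)_S`. The gradient of a continuous piecewise polynomial field is its classical
derivative, which exists outside the element boundaries. -/
noncomputable def dirichletForm {d : ℕ} (S : Set (Space d)) (u v : Space d → Space d) : ℝ :=
  ∫ x in S, gradInner (fderiv ℝ u x) (fderiv ℝ v x)

namespace OverlappingMeshes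

variable {d : ℕ} {Ω₁ Ω₂ : Set (Space d)} (M : OverlappingMeshes Ω₁ Ω₂)

open Classical in
/-- The mesh `T₁*`: the elements of the background mesh that are not completely overlapped. -/
noncomputable def T₁star : Finset (Finset (Space d)) :=
  M.T₀.cells.filter fun T =>
    simplex T ⊆ closure Ω₁ ∨ (0 < volume (simplex T ∩ Ω₁) ∧ 0 < volume (simplex T ∩ Ω₂))

/-- The overlap region `Ω_O = Ω₂ ∩ Ω₁*`. -/
noncomputable def overlap : Set (Space d) := Ω₂ ∩ region M.T₁star

/-- The composite velocity space `V_h = V_{h,1} ⊕ V_{h,2}` of order `k`. -/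
noncomputable def velocitySpace (k : ℕ) :
    Submodule ℝ ((Space d → Space d) × (Space d → Space d)) :=
  (feSpace M.T₁star k).prod (feSpace M.T₂.cells k)

/-- `(f, g)_Γ = ∑_{T ∈ T₂} ∫_{Γ ∩ T} f · g ds` for fields on `Γ` given element by element of the
mesh `T₂`; `μHE[d - 1]` is the surface measure. -/
noncomputable def interfaceInner (f g : Finset (Space d) → Space d → Space d) : ℝ :=
  ∑ T ∈ M.T₂.cells, ∫ x in interface Ω₁ Ω₂ ∩ simplex T, inner ℝ (f T x) (g T x) ∂μHE[d - 1]

/-- The squared interface norm `∑_{T ∈ T₂} h_T^{-2α} ‖f‖²_{Γ ∩ T}`. -/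
noncomputable def interfaceNormSq (α : ℝ) (f : Finset (Space d) → Space d → Space d) : ℝ :=
  ∑ T ∈ M.T₂.cells, meshSize T ^ (-2 * α) *
    ∫ x in interface Ω₁ Ω₂ ∩ simplex T, ‖f T x‖ ^ 2 ∂μHE[d - 1]

/-- The jump `[v] = v₂ - v₁` on the interface. -/
def jump (v : (Space d → Space d) × (Space d → Space d)) :
    Finset (Space d) → Space d → Space d :=
  fun _ x => v.2 x - v.1 x

/-- The mean `⟨∂_n v⟩ = ∂_n v₂` of the normal derivative on `Γ ∩ T`, taken from within the element
`T` of `T₂`; the normal points out of `Ω₂`, that is, from `Ω₂` into `Ω₁`. -/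
noncomputable def meanFlux (_M : OverlappingMeshes Ω₁ Ω₂)
    (v : (Space d → Space d) × (Space d → Space d)) :
    Finset (Space d) → Space d → Space d :=
  fun T x => fderivWithin ℝ v.2 (simplex T) x (outerNormal (closure Ω₂) x)

/-- The Nitsche form `a_h` with penalty parameter `γ`. -/
noncomputable def a (γ : ℝ) (u v : (Space d → Space d) × (Space d → Space d)) : ℝ :=
  dirichletForm Ω₁ u.1 v.1 + dirichletForm Ω₂ u.2 v.2
    - M.interfaceInner (M.meanFlux u) (jump v)
    - M.interfaceInner (M.meanFlux v) (jump u)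
    + γ * M.interfaceInner (fun T x => (meshSize T)⁻¹ • jump u T x) (jump v)

/-- The overlap penalty `s_h`. -/
noncomputable def s (u v : (Space d → Space d) × (Space d → Space d)) : ℝ :=
  dirichletForm M.overlap (u.1 - u.2) (v.1 - v.2)

/-- The norm `|||v|||_*`. -/
noncomputable def starNorm (v : (Space d → Space d) × (Space d → Space d)) : ℝ :=
  √((∑ T ∈ M.T₁star, dirichletForm (simplex T) v.1 v.1)
    + (∑ T ∈ M.T₂.cells, dirichletForm (simplex T) v.2 v.2)
    + M.interfaceNormSq (-1 / 2) (M.meanFlux v)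
    + M.interfaceNormSq (1 / 2) (jump v))

end OverlappingMeshes

end OverlapNitsche

/-!
The gradients of polynomial fields of degree at most `k` form a finite-dimensional space on which
the supremum over the unit ball is bounded by the `L²` norm over a small ball. Affine scaling turns
this into `h ^ d * |∇v|² ≤ C * ‖∇v‖²_T` on every simplex `T` of diameter `h` that contains a ball of
radius comparable to `h`. Each face of `T` lies in a Lipschitz image of a cube and has surface
measure at most `C * h ^ (d - 1)`. Since `Γ` meets `T` only in its boundary, it follows that
`h_T * ‖∂ₙv₂‖²_{Γ ∩ T} ≤ C * ‖∇v₂‖²_T`: the flux part of the star norm is controlled by `‖∇v₂‖`.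

Up to a null set `Ω₁*` consists of `Ω₁` and the overlap region, and there
`∇v₁ = ∇v₂ + ∇(v₁ - v₂)` is controlled by `∇v₂` and the penalty `s_h`. Continuity is then the
Cauchy–Schwarz inequality term by term. For coercivity, Young's inequality bounds the flux terms by
half of `‖∇v₂‖²` plus `2C` times the squared jump norm, which is absorbed once `γ ≥ 2C + 1`.

The flux is square integrable on `Γ` because the outer normal is measurable: near a point where a
set is a half space, the points with an outer normal lie on the bounding hyperplane and all have the
same normal, so the normal is locally constant on a locally closed set and zero elsewhere.
-/

namespace OverlapNitsche

open Module (finrank)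

/-! ### Inverse inequalities in finite-dimensional spaces of analytic functions -/

lemma exists_norm_le_mul_norm_of_ker_le {𝕜 V E F : Type*} [NontriviallyNormedField 𝕜]
    [CompleteSpace 𝕜] [AddCommGroup V] [Module 𝕜 V] [FiniteDimensional 𝕜 V]
    [SeminormedAddCommGroup E] [NormedSpace 𝕜 E] [NormedAddCommGroup F] [NormedSpace 𝕜 F]
    {f : V →ₗ[𝕜] E} {g : V →ₗ[𝕜] F} (hfg : LinearMap.ker g ≤ LinearMap.ker f) :
    ∃ C : ℝ, 0 < C ∧ ∀ v, ‖f v‖ ≤ C * ‖g v‖ := by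
  let φ : LinearMap.range g →L[𝕜] E := LinearMap.toContinuousLinearMap
    ((LinearMap.ker g).liftQ f hfg ∘ₗ g.quotKerEquivRange.symm.toLinearMap)
  have hφ (v : V) : φ ⟨g v, v, rfl⟩ = f v := by
    have hv : g.quotKerEquivRange.symm ⟨g v, v, rfl⟩ = (LinearMap.ker g).mkQ v :=
      g.quotKerEquivRange_symm_apply_image v _
    simp [φ, hv]
  refine ⟨‖φ‖ + 1, by positivity, fun v => ?_⟩
  calc ‖f v‖ = ‖φ ⟨g v, v, rfl⟩‖ := by rw [hφ]
    _ ≤ ‖φ‖ * ‖g v‖ := φ.le_opNorm _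
    _ ≤ (‖φ‖ + 1) * ‖g v‖ := by gcongr; linarith

lemma memLp_restrict_of_continuousOn {X F : Type*} [TopologicalSpace X]
    [MeasurableSpace X] [OpensMeasurableSpace X] [NormedAddCommGroup F] {μ : Measure X}
    {f : X → F} {K : Set X} (hf : ContinuousOn f K) (hK : IsCompact K) (hKm : MeasurableSet K)
    (hμK : μ K ≠ ⊤) (p : ENNReal) : MemLp f p (μ.restrict K) := by
  have : IsFiniteMeasure (μ.restrict K) := isFiniteMeasure_restrict.mpr hμK
  obtain ⟨C, hC⟩ := hK.exists_bound_of_continuousOn hf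
  exact .of_bound (hf.aestronglyMeasurable_of_isCompact hK hKm) C (ae_restrict_of_forall_mem hKm hC)

lemma norm_toLp_two_sq {X F : Type*} [MeasurableSpace X] [NormedAddCommGroup F] {μ : Measure X}
    {f : X → F} (hf : MemLp f 2 μ) : ‖hf.toLp f‖ ^ 2 = ∫ x, ‖f x‖ ^ 2 ∂μ := by
  rw [Lp.norm_toLp, hf.eLpNorm_eq_integral_rpow_norm two_ne_zero ENNReal.ofNat_ne_top,
    ENNReal.toReal_ofReal (by positivity), ← Real.rpow_natCast, ← Real.rpow_mul (by positivity)]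
  simp

lemma eq_zero_of_ae_restrict_eq_zero {E F : Type*} [NormedAddCommGroup E] [NormedSpace ℝ E]
    [MeasurableSpace E] [OpensMeasurableSpace E] {μ : Measure E} [μ.IsOpenPosMeasure]
    [NormedAddCommGroup F] [NormedSpace ℝ F] {w : E → F} (hw : AnalyticOnNhd ℝ w Set.univ)
    {U : Set E} (hU : IsOpen U) (hne : U.Nonempty) (h : w =ᵐ[μ.restrict U] 0) : w = 0 := by
  obtain ⟨x, hx⟩ := hne
  have hUw : Set.EqOn w 0 U := Measure.eqOn_open_of_ae_eq h hU
    (hw.continuousOn.mono (Set.subset_univ U)) continuousOn_const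
  exact hw.eq_of_eventuallyEq analyticOnNhd_const (hUw.eventuallyEq_of_mem (hU.mem_nhds hx))

section InverseInequality

variable {E F : Type*} [NormedAddCommGroup E] [NormedSpace ℝ E] [FiniteDimensional ℝ E]
  [MeasurableSpace E] [BorelSpace E] (μ : Measure E) [μ.IsAddHaarMeasure]
  [NormedAddCommGroup F] [NormedSpace ℝ F]

lemma exists_norm_sq_le_setIntegral_closedBall (W : Submodule ℝ (E → F)) [FiniteDimensional ℝ W]
    (hW : ∀ w ∈ W, AnalyticOnNhd ℝ w Set.univ) {r : ℝ} (hr : 0 < r) :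
    ∃ C : ℝ, 0 < C ∧ ∀ w ∈ W, ∀ z ∈ Metric.closedBall (0 : E) 1,
      ‖w z‖ ^ 2 ≤ C * ∫ x in Metric.closedBall (0 : E) r, ‖w x‖ ^ 2 ∂μ := by
  have hcont (w : W) : Continuous w.1 := continuousOn_univ.mp (hW w.1 w.2).continuousOn
  have hLp (w : W) : MemLp w.1 2 (μ.restrict (Metric.closedBall 0 r)) :=
    memLp_restrict_of_continuousOn (hcont w).continuousOn (isCompact_closedBall 0 r)
      measurableSet_closedBall measure_closedBall_lt_top.ne 2
  let f : W →ₗ[ℝ] C(Metric.closedBall (0 : E) 1, F) :=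
    { toFun := fun w => ⟨fun z => w.1 z, (hcont w).comp continuous_subtype_val⟩
      map_add' := fun _ _ => rfl
      map_smul' := fun _ _ => rfl }
  let g : W →ₗ[ℝ] Lp F 2 (μ.restrict (Metric.closedBall 0 r)) :=
    { toFun := fun w => (hLp w).toLp w.1
      map_add' := fun _ _ => rfl
      map_smul' := fun _ _ => rfl }
  have hker : LinearMap.ker g ≤ LinearMap.ker f := fun w hw => by
    have hae : w.1 =ᵐ[μ.restrict (Metric.closedBall 0 r)] 0 :=
      (hLp w).coeFn_toLp.symm.trans (Lp.eq_zero_iff_ae_eq_zero.mp hw)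
    have hw0 : w.1 = 0 := eq_zero_of_ae_restrict_eq_zero (hW w.1 w.2) Metric.isOpen_ball
      (Metric.nonempty_ball.mpr hr)
      (ae_restrict_of_ae_restrict_of_subset Metric.ball_subset_closedBall hae)
    rw [LinearMap.mem_ker, show w = 0 from Subtype.ext hw0, map_zero]
  obtain ⟨C, hC, hCfg⟩ := exists_norm_le_mul_norm_of_ker_le hker
  refine ⟨C ^ 2, by positivity, fun w hw z hz => ?_⟩
  calc ‖w z‖ ^ 2 ≤ (C * ‖g ⟨w, hw⟩‖) ^ 2 := by
        gcongr
        exact ((f ⟨w, hw⟩).norm_coe_le_norm ⟨z, hz⟩).trans (hCfg _)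
    _ = C ^ 2 * ∫ x in Metric.closedBall (0 : E) r, ‖w x‖ ^ 2 ∂μ := by
        rw [mul_pow, ← norm_toLp_two_sq (hLp ⟨w, hw⟩)]
        rfl

lemma setIntegral_closedBall_comp_affine (f : E → F) (a : E) {h r : ℝ} (hh : 0 < h) (hr : 0 ≤ r) :
    ∫ z in Metric.closedBall (0 : E) r, f (a + h • z) ∂μ =
      (h ^ finrank ℝ E)⁻¹ • ∫ x in Metric.closedBall a (h * r), f x ∂μ := by
  rw [Measure.setIntegral_comp_smul_of_pos μ (fun x => f (a + x)) (Metric.closedBall 0 r) hh,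
    smul_closedBall _ _ hr, smul_zero, Real.norm_of_nonneg hh.le,
    ← (measurePreserving_add_left μ a).setIntegral_preimage_emb (measurableEmbedding_addLeft a) f]
  simp

lemma exists_pow_mul_norm_sq_le_setIntegral_closedBall (W : Submodule ℝ (E → F))
    [FiniteDimensional ℝ W] (hW : ∀ w ∈ W, AnalyticOnNhd ℝ w Set.univ)
    (hcomp : ∀ w ∈ W, ∀ (a : E) (h : ℝ), 0 < h → (fun z => w (a + h • z)) ∈ W)
    {r : ℝ} (hr : 0 < r) :
    ∃ C : ℝ, 0 < C ∧ ∀ w ∈ W, ∀ (a : E) (h : ℝ), 0 < h → ∀ y ∈ Metric.closedBall a h,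
      h ^ finrank ℝ E * ‖w y‖ ^ 2 ≤ C * ∫ x in Metric.closedBall a (h * r), ‖w x‖ ^ 2 ∂μ := by
  obtain ⟨C, hC, hunit⟩ := exists_norm_sq_le_setIntegral_closedBall μ W hW hr
  refine ⟨C, hC, fun w hw a h hh y hy => ?_⟩
  have hz : h⁻¹ • (y - a) ∈ Metric.closedBall (0 : E) 1 := by
    rwa [mem_closedBall_zero_iff, norm_smul, norm_inv, Real.norm_of_nonneg hh.le,
      inv_mul_le_iff₀ hh, mul_one, ← dist_eq_norm]
  have hyz : a + h • h⁻¹ • (y - a) = y := by rw [smul_inv_smul₀ hh.ne', add_sub_cancel]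
  have hscaled := hunit _ (hcomp w hw a h hh) _ hz
  rw [hyz, setIntegral_closedBall_comp_affine μ (fun x => ‖w x‖ ^ 2) a hh hr.le,
    smul_eq_mul, mul_left_comm, ← div_eq_inv_mul, le_div_iff₀ (by positivity)] at hscaled
  rwa [mul_comm]

end InverseInequality

/-! ### Polynomial vector fields and their gradients -/

lemma totalDegree_aeval_le {ι κ R : Type*} [CommSemiring R] {f : ι → MvPolynomial κ R} {n : ℕ}
    (hf : ∀ i, (f i).totalDegree ≤ n) (p : MvPolynomial ι R) :
    (MvPolynomial.aeval f p).totalDegree ≤ p.totalDegree * n := by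
  rw [MvPolynomial.aeval_def, MvPolynomial.eval₂_eq]
  refine MvPolynomial.totalDegree_finsetSum_le fun m hm => ?_
  calc (algebraMap R (MvPolynomial κ R) (p.coeff m) * ∏ i ∈ m.support, f i ^ m i).totalDegree
      ≤ (∏ i ∈ m.support, f i ^ m i).totalDegree := by
        rw [MvPolynomial.algebraMap_eq, ← MvPolynomial.smul_eq_C_mul]
        exact MvPolynomial.totalDegree_smul_le _ _
    _ ≤ ∑ i ∈ m.support, (f i ^ m i).totalDegree := MvPolynomial.totalDegree_finsetProd _ _
    _ ≤ ∑ i ∈ m.support, m i * n := Finset.sum_le_sum fun i _ =>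
        (MvPolynomial.totalDegree_pow _ _).trans (Nat.mul_le_mul_left _ (hf i))
    _ ≤ p.totalDegree * n := by
        rw [← Finset.sum_mul]
        exact Nat.mul_le_mul_right _ (MvPolynomial.le_totalDegree hm)

section PolynomialFields

variable {d k : ℕ}

/-- The vector field on `ℝ^d` whose components are the polynomials `p i`, as a linear function of
these polynomials. -/
noncomputable def polyField (d : ℕ) :
    (Fin d → MvPolynomial (Fin d) ℝ) →ₗ[ℝ] Space d → Space d where
  toFun p x := WithLp.toLp 2 fun i => MvPolynomial.eval (fun j => x j) (p i)
  map_add' p q := by ext x i; simp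
  map_smul' c p := by ext x i; simp [MvPolynomial.smul_eval]

/-- The vector fields on `ℝ^d` whose components are polynomials of total degree at most `k`. -/
noncomputable def polyFieldSpace (d k : ℕ) : Submodule ℝ (Space d → Space d) :=
  LinearMap.range
    (polyField d ∘ₗ (MvPolynomial.restrictTotalDegree (Fin d) ℝ k).subtype.compLeft (Fin d))

instance : FiniteDimensional ℝ (polyFieldSpace d k) := by
  unfold polyFieldSpace; infer_instance

lemma polyField_mem_polyFieldSpace {p : Fin d → MvPolynomial (Fin d) ℝ}
    (hp : ∀ i, (p i).totalDegree ≤ k) : polyField d p ∈ polyFieldSpace d k :=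
  ⟨fun i => ⟨p i, (MvPolynomial.mem_restrictTotalDegree _ _ _).mpr (hp i)⟩, rfl⟩

lemma exists_polyField_eq {v : Space d → Space d} (hv : v ∈ polyFieldSpace d k) :
    ∃ p, (∀ i, (p i).totalDegree ≤ k) ∧ polyField d p = v := by
  obtain ⟨p, rfl⟩ := hv
  exact ⟨fun i => p i, fun i => (MvPolynomial.mem_restrictTotalDegree _ _ _).mp (p i).2, rfl⟩

lemma analyticOnNhd_of_mem_polyFieldSpace {v : Space d → Space d} (hv : v ∈ polyFieldSpace d k) :
    AnalyticOnNhd ℝ v Set.univ := by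
  obtain ⟨p, -, rfl⟩ := exists_polyField_eq hv
  have hcoord (i : Fin d) :
      AnalyticOnNhd ℝ (fun x : Space d => MvPolynomial.eval (fun j => x j) (p i)) Set.univ :=
    AnalyticOnNhd.eval_continuousLinearMap'
      (fun j => (EuclideanSpace.proj j : Space d →L[ℝ] ℝ)) (p i)
  exact (EuclideanSpace.equiv (Fin d) ℝ).symm.toContinuousLinearMap.comp_analyticOnNhd
    (AnalyticOnNhd.pi hcoord)

lemma differentiable_of_mem_polyFieldSpace {v : Space d → Space d} (hv : v ∈ polyFieldSpace d k) :
    Differentiable ℝ v :=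
  differentiableOn_univ.mp (analyticOnNhd_of_mem_polyFieldSpace hv).differentiableOn

lemma comp_affine_mem_polyFieldSpace {v : Space d → Space d} (hv : v ∈ polyFieldSpace d k)
    (a : Space d) (h : ℝ) : (fun z => v (a + h • z)) ∈ polyFieldSpace d k := by
  obtain ⟨p, hp, rfl⟩ := exists_polyField_eq hv
  let A (j : Fin d) : MvPolynomial (Fin d) ℝ := MvPolynomial.C (a j) + h • MvPolynomial.X j
  have hA (j : Fin d) : (A j).totalDegree ≤ 1 :=
    (MvPolynomial.totalDegree_add _ _).trans
      (max_le (by simp) ((MvPolynomial.totalDegree_smul_le _ _).trans (by simp)))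
  have hdeg (i : Fin d) : (MvPolynomial.aeval A (p i)).totalDegree ≤ k :=
    (totalDegree_aeval_le hA (p i)).trans (by simpa using hp i)
  convert polyField_mem_polyFieldSpace hdeg using 1
  ext z i
  have hAz : (fun j => MvPolynomial.aeval (fun l => z l) (A j)) = fun j => (a + h • z) j := by
    ext j
    simp [A]
  simp only [polyField, LinearMap.coe_mk, AddHom.coe_mk, ← hAz, ← MvPolynomial.coe_aeval_eq_eval,
    RingHom.coe_coe, ← MvPolynomial.comp_aeval_apply]

/-- The columns of the Jacobian matrix with derivative `A`. In the `ℓ²` sum of the column spaces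
the inner product is the Frobenius product `gradInner`. -/
noncomputable def gradColumns (d : ℕ) :
    (Space d →L[ℝ] Space d) →L[ℝ] PiLp 2 fun _ : Fin d => Space d :=
  (PiLp.continuousLinearEquiv 2 ℝ fun _ => Space d).symm.toContinuousLinearMap ∘L
    ContinuousLinearMap.pi fun j =>
      ContinuousLinearMap.apply ℝ (Space d) (EuclideanSpace.single j 1)

lemma inner_gradColumns (A B : Space d →L[ℝ] Space d) :
    inner ℝ (gradColumns d A) (gradColumns d B) = gradInner A B := PiLp.inner_apply _ _

lemma norm_gradColumns_sq_eq_sum (A : Space d →L[ℝ] Space d) :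
    ‖gradColumns d A‖ ^ 2 = ∑ j, ‖A (EuclideanSpace.single j 1)‖ ^ 2 := by
  rw [PiLp.norm_sq_eq_of_L2]; rfl

lemma norm_apply_le_norm_gradColumns_mul (A : Space d →L[ℝ] Space d) (x : Space d) :
    ‖A x‖ ≤ ‖gradColumns d A‖ * ‖x‖ := by
  have hx : A x = ∑ j, x j • A (EuclideanSpace.single j 1) := by
    conv_lhs => rw [← (EuclideanSpace.basisFun (Fin d) ℝ).sum_repr x]
    simp [map_sum]
  refine le_of_sq_le_sq ?_ (by positivity)
  calc ‖A x‖ ^ 2 ≤ (∑ j, ‖x j‖ * ‖A (EuclideanSpace.single j 1)‖) ^ 2 := by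
        rw [hx]
        gcongr
        exact (norm_sum_le _ _).trans_eq (by simp only [norm_smul])
    _ ≤ (∑ j, ‖x j‖ ^ 2) * ∑ j, ‖A (EuclideanSpace.single j 1)‖ ^ 2 :=
        Finset.sum_mul_sq_le_sq_mul_sq _ _ _
    _ = (‖gradColumns d A‖ * ‖x‖) ^ 2 := by
        rw [mul_pow, norm_gradColumns_sq_eq_sum, EuclideanSpace.norm_sq_eq, mul_comm]

/-- The gradient of `v`, as a field of Jacobian columns. -/
noncomputable def gradField (v : Space d → Space d) (x : Space d) :
    PiLp 2 fun _ : Fin d => Space d :=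
  gradColumns d (fderiv ℝ v x)

/-- The map `v ↦ gradField v` on the fields with components of degree at most `k`. -/
noncomputable def polyGrad (d k : ℕ) :
    polyFieldSpace d k →ₗ[ℝ] Space d → PiLp 2 fun _ : Fin d => Space d where
  toFun v := gradField v.1
  map_add' u v := by
    ext1 x
    simp [gradField, fderiv_add (differentiable_of_mem_polyFieldSpace u.2 x)
      (differentiable_of_mem_polyFieldSpace v.2 x)]
  map_smul' c v := by
    ext1 x
    simp [gradField, fderiv_const_smul (differentiable_of_mem_polyFieldSpace v.2 x)]

/-- The gradients of the fields in `polyFieldSpace d k`. -/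
noncomputable def polyGradSpace (d k : ℕ) :
    Submodule ℝ (Space d → PiLp 2 fun _ : Fin d => Space d) :=
  LinearMap.range (polyGrad d k)

instance : FiniteDimensional ℝ (polyGradSpace d k) := by unfold polyGradSpace; infer_instance

lemma gradField_mem_polyGradSpace {v : Space d → Space d} (hv : v ∈ polyFieldSpace d k) :
    gradField v ∈ polyGradSpace d k := ⟨⟨v, hv⟩, rfl⟩

lemma analyticOnNhd_gradField {v : Space d → Space d} (hv : v ∈ polyFieldSpace d k) :
    AnalyticOnNhd ℝ (gradField v) Set.univ :=
  (gradColumns d).comp_analyticOnNhd (analyticOnNhd_of_mem_polyFieldSpace hv).fderiv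

lemma continuous_gradField {v : Space d → Space d} (hv : v ∈ polyFieldSpace d k) :
    Continuous (gradField v) :=
  continuousOn_univ.mp (analyticOnNhd_gradField hv).continuousOn

lemma gradField_comp_affine (v : Space d → Space d) (a : Space d) {h : ℝ} (x : Space d) :
    gradField (fun z => v (a + h • z)) x = h • gradField v (a + h • x) := by
  rw [gradField, gradField, fderiv_comp_smul (f := fun y => v (a + y)), fderiv_comp_add_left,
    map_smul]

lemma comp_affine_mem_polyGradSpace {w} (hw : w ∈ polyGradSpace d k) (a : Space d) {h : ℝ}
    (hh : h ≠ 0) : (fun z => w (a + h • z)) ∈ polyGradSpace d k := by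
  obtain ⟨v, rfl⟩ := hw
  convert (polyGradSpace d k).smul_mem h⁻¹
    (gradField_mem_polyGradSpace (comp_affine_mem_polyFieldSpace v.2 a h)) using 1
  ext1 z
  rw [Pi.smul_apply, gradField_comp_affine, inv_smul_smul₀ hh]
  rfl

lemma exists_pow_mul_norm_gradField_sq_le (d k : ℕ) {r : ℝ} (hr : 0 < r) :
    ∃ C : ℝ, 0 < C ∧ ∀ v ∈ polyFieldSpace d k, ∀ (a : Space d) (h : ℝ), 0 < h →
      ∀ y ∈ Metric.closedBall a h, h ^ d * ‖gradField v y‖ ^ 2 ≤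
        C * ∫ x in Metric.closedBall a (h * r), ‖gradField v x‖ ^ 2 := by
  obtain ⟨C, hC, hinv⟩ := exists_pow_mul_norm_sq_le_setIntegral_closedBall volume
    (polyGradSpace d k) (fun w ⟨v, hvw⟩ => hvw ▸ analyticOnNhd_gradField v.2)
    (fun w hw a h hh => comp_affine_mem_polyGradSpace hw a hh.ne') hr
  refine ⟨C, hC, fun v hv => ?_⟩
  simpa only [finrank_euclideanSpace_fin] using hinv _ (gradField_mem_polyGradSpace hv)

end PolynomialFields

/-! ### Simplices and meshes -/

section Simplex

variable {ι E : Type*} [NormedAddCommGroup E] [NormedSpace ℝ E]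

lemma frontier_convexHull_range_subset [Finite ι] [FiniteDimensional ℝ E]
    (b : AffineBasis ι ℝ E) :
    frontier (convexHull ℝ (Set.range b)) ⊆ ⋃ i, convexHull ℝ (b '' {i}ᶜ) := by
  classical
  have := Fintype.ofFinite ι
  rintro x ⟨hx, hxi⟩
  rw [((Set.finite_range b).isClosed_convexHull ℝ).closure_eq, b.convexHull_eq_nonneg_coord] at hx
  rw [b.interior_convexHull] at hxi
  obtain ⟨i, hi⟩ := not_forall.mp hxi
  have hi0 : b.coord i x = 0 := le_antisymm (not_lt.mp hi) (hx i)
  have hsum : ∑ j ∈ Finset.univ.erase i, b.coord j x = 1 := by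
    rw [Finset.sum_erase (f := fun j => b.coord j x) _ hi0, b.sum_coord_apply_eq_one]
  have hcomb : ∑ j ∈ Finset.univ.erase i, b.coord j x • b j = x := by
    rw [Finset.sum_erase _ (by rw [hi0, zero_smul]), b.linear_combination_coord_eq_self]
  refine Set.mem_iUnion.mpr ⟨i, ?_⟩
  rw [← hcomb]
  exact (convex_convexHull ℝ _).sum_mem (fun j _ => hx j) hsum fun j hj =>
    subset_convexHull ℝ _ ⟨j, Finset.ne_of_mem_erase hj, rfl⟩

variable [Fintype ι]

lemma convexHull_insert_range_subset_image_Icc (p : E) (q : ι → E) :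
    convexHull ℝ (insert p (Set.range q)) ⊆
      (fun t : ι → ℝ => p + Fintype.linearCombination ℝ (fun i => q i - p) t) '' Set.Icc 0 1 := by
  classical
  refine convexHull_min (Set.insert_subset ?_ ?_) ?_
  · exact ⟨0, Set.left_mem_Icc.mpr zero_le_one, by simp⟩
  · rintro _ ⟨i, rfl⟩
    refine ⟨Pi.single i 1, ⟨Pi.single_nonneg.mpr zero_le_one, fun j => ?_⟩, ?_⟩
    · by_cases hj : j = i <;> simp [hj]
    · simp [Fintype.linearCombination_apply_single]
  · rw [← Set.image_image (fun x => p + x)]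
    exact ((convex_Icc 0 1).linear_image _).translate p

lemma hausdorffMeasure_convexHull_insert_range_le [MeasurableSpace E] [BorelSpace E]
    (p : E) (q : ι → E) {h : NNReal} (hq : ∀ i, dist (q i) p ≤ h) :
    μH[Fintype.card ι] (convexHull ℝ (insert p (Set.range q))) ≤
      (Fintype.card ι * h : NNReal) ^ Fintype.card ι := by
  have hlip : LipschitzWith (Fintype.card ι * h)
      fun t : ι → ℝ => p + Fintype.linearCombination ℝ (fun i => q i - p) t := by
    refine LipschitzWith.of_dist_le_mul fun s t => ?_
    rw [dist_add_left, dist_eq_norm, ← map_sub, Fintype.linearCombination_apply]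
    calc ‖∑ i, (s - t) i • (q i - p)‖ ≤ ∑ _i : ι, dist s t * h := by
          refine (norm_sum_le _ _).trans (Finset.sum_le_sum fun i _ => ?_)
          rw [norm_smul, ← dist_eq_norm (q i), dist_eq_norm s]
          exact mul_le_mul (norm_le_pi_norm (s - t) i) (hq i) dist_nonneg (norm_nonneg _)
      _ = ↑(Fintype.card ι * h) * dist s t := by
          rw [Finset.sum_const, Finset.card_univ, nsmul_eq_mul]
          push_cast
          ring
  calc μH[Fintype.card ι] (convexHull ℝ (insert p (Set.range q)))
      ≤ μH[Fintype.card ι] (_ '' Set.Icc (0 : ι → ℝ) 1) :=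
        measure_mono (convexHull_insert_range_subset_image_Icc p q)
    _ ≤ (Fintype.card ι * h : NNReal) ^ (Fintype.card ι : ℝ) *
          μH[Fintype.card ι] (Set.Icc (0 : ι → ℝ) 1) :=
        hlip.lipschitzOnWith.hausdorffMeasure_image_le (Nat.cast_nonneg _)
    _ = (Fintype.card ι * h : NNReal) ^ Fintype.card ι := by
        rw [hausdorffMeasure_pi_real, Real.volume_Icc_pi, ENNReal.rpow_natCast]
        simp

lemma hausdorffMeasure_frontier_convexHull_le [FiniteDimensional ℝ E] [MeasurableSpace E]
    [BorelSpace E] (b : AffineBasis ι ℝ E) {m : ℕ} (hι : Fintype.card ι = m + 2) {h : NNReal}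
    (hb : ∀ i j, dist (b i) (b j) ≤ h) :
    μH[m] (frontier (convexHull ℝ (Set.range b))) ≤ (m + 2) * (m * h : NNReal) ^ m := by
  classical
  have : Nontrivial ι := Fintype.one_lt_card_iff_nontrivial.mp (by omega)
  have hface (i : ι) : μH[m] (convexHull ℝ (b '' {i}ᶜ)) ≤ (m * h : NNReal) ^ m := by
    obtain ⟨j, hj⟩ := exists_ne i
    have hm : Fintype.card ({i, j}ᶜ : Finset ι) = m := by
      rw [Fintype.card_coe, Finset.card_compl, Finset.card_pair hj.symm, hι, Nat.add_sub_cancel]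
    have hins : b '' {i}ᶜ ⊆ insert (b j) (Set.range fun l : ({i, j}ᶜ : Finset ι) => b l) := by
      rintro _ ⟨l, hl, rfl⟩
      by_cases hlj : l = j
      · exact Or.inl (congrArg b hlj)
      · exact Or.inr ⟨⟨l, by simpa using ⟨hl, hlj⟩⟩, rfl⟩
    have hle := hausdorffMeasure_convexHull_insert_range_le (b j)
      (fun l : ({i, j}ᶜ : Finset ι) => b l) fun l => hb l j
    rw [hm] at hle
    exact (measure_mono (convexHull_mono hins)).trans hle
  calc μH[m] (frontier (convexHull ℝ (Set.range b)))
      ≤ ∑ i, μH[m] (convexHull ℝ (b '' {i}ᶜ)) :=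
        (measure_mono (frontier_convexHull_range_subset b)).trans (measure_iUnion_fintype_le _ _)
    _ ≤ ∑ _i : ι, ((m * h : NNReal) : ENNReal) ^ m := Finset.sum_le_sum fun i _ => hface i
    _ = (m + 2) * (m * h : NNReal) ^ m := by
        rw [Finset.sum_const, Finset.card_univ, hι, nsmul_eq_mul]
        push_cast
        rfl

lemma addHaar_convexHull_eq_zero_of_card_le [FiniteDimensional ℝ E] [MeasurableSpace E]
    [BorelSpace E] (μ : Measure E) [μ.IsAddHaarMeasure] {S : Finset E}
    (hS : S.card ≤ finrank ℝ E) : μ (convexHull ℝ (S : Set E)) = 0 := by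
  obtain rfl | hne := S.eq_empty_or_nonempty
  · simp
  refine measure_mono_null (convexHull_subset_affineSpan _)
    (Measure.addHaar_affineSubspace μ _ fun htop => ?_)
  have hspan : vectorSpan ℝ (S : Set E) = ⊤ := by
    rw [← direction_affineSpan, htop, AffineSubspace.direction_top]
  have hcard : Fintype.card S = (S.card - 1) + 1 := by
    rw [Fintype.card_coe, Nat.sub_add_cancel hne.card_pos]
  have hle := finrank_vectorSpan_range_le ℝ (fun p : S => (p : E)) hcard
  rw [Subtype.range_coe_subtype, Finset.setOfPred_mem, hspan, finrank_top] at hle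
  have := hne.card_pos
  omega

end Simplex

section Mesh

variable {d : ℕ}

lemma isCompact_simplex (T : Finset (Space d)) : IsCompact (simplex T) :=
  T.finite_toSet.isCompact_convexHull ℝ

lemma measurableSet_simplex (T : Finset (Space d)) : MeasurableSet (simplex T) :=
  (isCompact_simplex T).measurableSet

lemma dist_le_meshSize {T : Finset (Space d)} {x y : Space d} (hx : x ∈ simplex T)
    (hy : y ∈ simplex T) : dist x y ≤ meshSize T :=
  Metric.dist_le_diam_of_mem (isCompact_simplex T).isBounded hx hy

lemma meshSize_nonneg (T : Finset (Space d)) : 0 ≤ meshSize T := Metric.diam_nonneg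

lemma volume_frontier_simplex (T : Finset (Space d)) : volume (frontier (simplex T)) = 0 :=
  (convex_convexHull ℝ _).addHaar_frontier volume

lemma isCompact_region (cells : Finset (Finset (Space d))) : IsCompact (region cells) :=
  cells.isCompact_biUnion fun T _ => isCompact_simplex T

lemma simplex_subset_region {cells : Finset (Finset (Space d))} {T : Finset (Space d)}
    (hT : T ∈ cells) : simplex T ⊆ region cells :=
  Set.subset_biUnion_of_mem (u := fun T => simplex T) hT

lemma ae_mem_interior_of_mem_region (cells : Finset (Finset (Space d))) :
    ∀ᵐ x, x ∈ region cells → ∃ T ∈ cells, x ∈ interior (simplex T) := by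
  have hfrontier : ∀ᵐ x, ∀ T ∈ cells, x ∉ frontier (simplex T) :=
    (Filter.eventually_all_finset cells).mpr fun T _ =>
      measure_eq_zero_iff_ae_notMem.mp (volume_frontier_simplex T)
  filter_upwards [hfrontier] with x hx hxr
  obtain ⟨T, hT, hxT⟩ := Set.mem_iUnion₂.mp hxr
  exact ⟨T, hT, by_contra fun hxi => hx T hT ⟨subset_closure hxT, hxi⟩⟩

namespace SimplicialMesh

variable (M : SimplicialMesh d) {S T : Finset (Space d)}

/-- The vertices of an element of a mesh, as an affine basis of `ℝ^d`. -/
def affineBasis (hT : T ∈ M.cells) : AffineBasis T ℝ (Space d) where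
  toFun p := p
  ind' := M.affineIndependent T hT
  tot' := by
    rw [(M.affineIndependent T hT).affineSpan_eq_top_iff_card_eq_finrank_add_one]
    simp [M.card_eq T hT]

lemma range_affineBasis (hT : T ∈ M.cells) : Set.range (M.affineBasis hT) = T :=
  Subtype.range_coe

lemma interior_simplex_nonempty (hT : T ∈ M.cells) : (interior (simplex T)).Nonempty := by
  rw [simplex, ← M.range_affineBasis hT]
  exact interior_convexHull_nonempty_iff_affineSpan_eq_top.mpr (M.affineBasis hT).tot

lemma meshSize_pos (hd : 1 ≤ d) (hT : T ∈ M.cells) : 0 < meshSize T := by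
  have hcard := M.card_eq T hT
  obtain ⟨x, hx, y, hy, hxy⟩ := Finset.one_lt_card.mp (by omega : 1 < T.card)
  exact (dist_pos.mpr hxy).trans_le
    (dist_le_meshSize (subset_convexHull ℝ _ hx) (subset_convexHull ℝ _ hy))

lemma volume_inter (hS : S ∈ M.cells) (hT : T ∈ M.cells) (hne : S ≠ T) :
    volume (simplex S ∩ simplex T) = 0 := by
  classical
  rw [M.inter_eq S hS T hT, ← Finset.coe_inter]
  refine addHaar_convexHull_eq_zero_of_card_le volume ?_
  have hlt : (S ∩ T).card < S.card := Finset.card_lt_card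
    (Finset.inter_subset_left.ssubset_of_ne fun h => hne (Finset.eq_of_subset_of_card_le
      (Finset.inter_eq_left.mp h) (by rw [M.card_eq S hS, M.card_eq T hT])))
  rw [M.card_eq S hS] at hlt
  simpa using Nat.lt_succ_iff.mp hlt

lemma integral_region {cells : Finset (Finset (Space d))} (hsub : cells ⊆ M.cells)
    {F : Type*} [NormedAddCommGroup F] [NormedSpace ℝ F] {f : Space d → F}
    (hf : ∀ T ∈ cells, IntegrableOn f (simplex T)) :
    ∫ x in region cells, f x = ∑ T ∈ cells, ∫ x in simplex T, f x := by
  have hregion : region cells = ⋃ T : cells, simplex T.1 := by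
    simp only [region, Set.iUnion_subtype]
  have hdisjoint (S T : cells) (hne : S ≠ T) : volume (simplex S.1 ∩ simplex T.1) = 0 :=
    M.volume_inter (hsub S.2) (hsub T.2) (Subtype.coe_ne_coe.mpr hne)
  have hunion := integral_iUnion_ae (fun T : cells => (measurableSet_simplex T.1).nullMeasurableSet)
    (fun S T hne => hdisjoint S T hne) (integrableOn_finite_iUnion.mpr fun T => hf T T.2)
  rw [hregion, hunion, tsum_fintype]
  exact Finset.sum_coe_sort cells fun T => ∫ x in simplex T, f x

lemma exists_surfaceMeasure_frontier_simplex_le (hd : 1 ≤ d) :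
    ∃ C : ℝ, 0 < C ∧ ∀ (M : SimplicialMesh d), ∀ T ∈ M.cells,
      μHE[d - 1] (frontier (simplex T)) ≤ ENNReal.ofReal (C * meshSize T ^ (d - 1)) := by
  obtain ⟨m, rfl⟩ := Nat.exists_eq_add_of_le' hd
  let κ := Measure.addHaarScalarFactor (volume : Measure (EuclideanSpace ℝ (Fin m))) μH[m]
  refine ⟨(κ * (m + 2) * m ^ m + 1 : NNReal), by positivity, fun M T hT => ?_⟩
  let h : NNReal := ⟨meshSize T, meshSize_nonneg T⟩
  have hcard : Fintype.card T = m + 2 := by rw [Fintype.card_coe, M.card_eq T hT]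
  have hfrontier := hausdorffMeasure_frontier_convexHull_le (M.affineBasis hT) hcard (h := h)
    fun p q => dist_le_meshSize (subset_convexHull ℝ _ p.2) (subset_convexHull ℝ _ q.2)
  rw [M.range_affineBasis] at hfrontier
  calc μHE[m + 1 - 1] (frontier (simplex T)) = κ * μH[m] (frontier (simplex T)) := by
        rw [Nat.add_sub_cancel, Measure.euclideanHausdorffMeasure_def, Measure.smul_apply]
        rfl
    _ ≤ κ * ((m + 2) * (m * h : NNReal) ^ m) := by gcongr
    _ = (κ * (m + 2) * m ^ m * h ^ m : NNReal) := by
        push_cast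
        ring
    _ ≤ ((κ * (m + 2) * m ^ m + 1) * h ^ m : NNReal) := by
        gcongr
        exact le_self_add
    _ = ENNReal.ofReal ((κ * (m + 2) * m ^ m + 1 : NNReal) * meshSize T ^ m) :=
      (ENNReal.ofReal_coe_nnreal (p := (κ * (m + 2) * m ^ m + 1) * h ^ m)).symm

end SimplicialMesh

end Mesh

/-! ### The Dirichlet form of piecewise polynomial fields -/

section L2

variable {X F : Type*} [MeasurableSpace X] [NormedAddCommGroup F] {μ : Measure X} {f g : X → F}

lemma abs_integral_inner_le_sqrt_mul_sqrt [InnerProductSpace ℝ F] (hf : MemLp f 2 μ)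
    (hg : MemLp g 2 μ) :
    |∫ x, inner ℝ (f x) (g x) ∂μ| ≤ √(∫ x, ‖f x‖ ^ 2 ∂μ) * √(∫ x, ‖g x‖ ^ 2 ∂μ) := by
  have hinner : ∫ x, inner ℝ (f x) (g x) ∂μ = inner ℝ (hf.toLp f) (hg.toLp g) := by
    rw [L2.inner_def]
    refine integral_congr_ae ?_
    filter_upwards [hf.coeFn_toLp, hg.coeFn_toLp] with x hfx hgx
    rw [hfx, hgx]
  rw [hinner, ← norm_toLp_two_sq hf, ← norm_toLp_two_sq hg, Real.sqrt_sq (norm_nonneg _),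
    Real.sqrt_sq (norm_nonneg _)]
  exact abs_real_inner_le_norm _ _

lemma integral_norm_add_sq_le (hf : MemLp f 2 μ) (hg : MemLp g 2 μ) :
    ∫ x, ‖f x + g x‖ ^ 2 ∂μ ≤ 2 * ∫ x, ‖f x‖ ^ 2 ∂μ + 2 * ∫ x, ‖g x‖ ^ 2 ∂μ := by
  rw [← norm_toLp_two_sq hf, ← norm_toLp_two_sq hg, ← mul_add]
  calc ∫ x, ‖f x + g x‖ ^ 2 ∂μ
      = ‖hf.toLp f + hg.toLp g‖ ^ 2 := (norm_toLp_two_sq (hf.add hg)).symm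
    _ ≤ (‖hf.toLp f‖ + ‖hg.toLp g‖) ^ 2 := by gcongr; exact norm_add_le _ _
    _ ≤ 2 * (‖hf.toLp f‖ ^ 2 + ‖hg.toLp g‖ ^ 2) := add_sq_le

end L2

section Dirichlet

variable {d k : ℕ} {S : Set (Space d)} {T : Finset (Space d)} {u v w : Space d → Space d}

lemma dirichletForm_eq_integral_inner (S : Set (Space d)) (u v : Space d → Space d) :
    dirichletForm S u v = ∫ x in S, inner ℝ (gradField u x) (gradField v x) := by
  simp only [dirichletForm, gradField, inner_gradColumns]

lemma dirichletForm_self (S : Set (Space d)) (v : Space d → Space d) :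
    dirichletForm S v v = ∫ x in S, ‖gradField v x‖ ^ 2 := by
  simp only [dirichletForm_eq_integral_inner, real_inner_self_eq_norm_sq]

lemma dirichletForm_self_nonneg (S : Set (Space d)) (v : Space d → Space d) :
    0 ≤ dirichletForm S v v := by
  rw [dirichletForm_self]
  exact integral_nonneg fun x => sq_nonneg _

lemma abs_dirichletForm_le (hu : MemLp (gradField u) 2 (volume.restrict S))
    (hv : MemLp (gradField v) 2 (volume.restrict S)) :
    |dirichletForm S u v| ≤ √(dirichletForm S u u) * √(dirichletForm S v v) := by
  rw [dirichletForm_eq_integral_inner, dirichletForm_self, dirichletForm_self]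
  exact abs_integral_inner_le_sqrt_mul_sqrt hu hv

lemma dirichletForm_mono {S' : Set (Space d)} (hSS' : S ≤ᵐ[volume] S')
    (hv : MemLp (gradField v) 2 (volume.restrict S')) :
    dirichletForm S v v ≤ dirichletForm S' v v := by
  rw [dirichletForm_self, dirichletForm_self]
  exact setIntegral_mono_set (hv.integrable_norm_pow two_ne_zero)
    (ae_of_all _ fun x => sq_nonneg _) hSS'

lemma gradField_eventuallyEq_restrict_simplex (hvw : Set.EqOn v w (simplex T)) :
    gradField v =ᵐ[volume.restrict (simplex T)] gradField w := by
  rw [Filter.EventuallyEq, ae_restrict_iff' (measurableSet_simplex T)]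
  filter_upwards [measure_eq_zero_iff_ae_notMem.mp (volume_frontier_simplex T)] with x hx hxT
  have hxi : simplex T ∈ nhds x :=
    mem_interior_iff_mem_nhds.mp (by_contra fun hxi => hx ⟨subset_closure hxT, hxi⟩)
  rw [gradField, gradField, (hvw.eventuallyEq_of_mem hxi).fderiv_eq]

lemma dirichletForm_simplex_congr (hvw : Set.EqOn v w (simplex T)) :
    dirichletForm (simplex T) v v = dirichletForm (simplex T) w w := by
  rw [dirichletForm_self, dirichletForm_self]
  exact integral_congr_ae ((gradField_eventuallyEq_restrict_simplex hvw).mono fun x hx =>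
    congrArg (‖·‖ ^ 2) hx)

lemma gradField_sub_ae_eq (hu : ∀ᵐ x ∂volume.restrict S, DifferentiableAt ℝ u x)
    (hv : ∀ᵐ x ∂volume.restrict S, DifferentiableAt ℝ v x) :
    gradField (u - v) =ᵐ[volume.restrict S] gradField u - gradField v := by
  filter_upwards [hu, hv] with x hux hvx
  rw [Pi.sub_apply, gradField, fderiv_sub hux hvx, map_sub]
  rfl

lemma dirichletForm_sub_le (hu : ∀ᵐ x ∂volume.restrict S, DifferentiableAt ℝ u x)
    (hv : ∀ᵐ x ∂volume.restrict S, DifferentiableAt ℝ v x)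
    (hu2 : MemLp (gradField u) 2 (volume.restrict S))
    (hv2 : MemLp (gradField v) 2 (volume.restrict S)) :
    dirichletForm S (u - v) (u - v) ≤ 2 * dirichletForm S u u + 2 * dirichletForm S v v := by
  simp only [dirichletForm_self]
  calc ∫ x in S, ‖gradField (u - v) x‖ ^ 2 = ∫ x in S, ‖gradField u x + -gradField v x‖ ^ 2 :=
        integral_congr_ae ((gradField_sub_ae_eq hu hv).mono fun x hx => by
          beta_reduce
          rw [hx, Pi.sub_apply, sub_eq_add_neg])
    _ ≤ _ := by simpa only [Pi.neg_apply, norm_neg] using integral_norm_add_sq_le hu2 hv2.neg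

lemma dirichletForm_le_add_sub (hu : ∀ᵐ x ∂volume.restrict S, DifferentiableAt ℝ u x)
    (hv : ∀ᵐ x ∂volume.restrict S, DifferentiableAt ℝ v x)
    (hu2 : MemLp (gradField u) 2 (volume.restrict S))
    (hv2 : MemLp (gradField v) 2 (volume.restrict S)) :
    dirichletForm S u u ≤ 2 * dirichletForm S (u - v) (u - v) + 2 * dirichletForm S v v := by
  have hsub := gradField_sub_ae_eq hu hv
  simp only [dirichletForm_self]
  calc ∫ x in S, ‖gradField u x‖ ^ 2 = ∫ x in S, ‖gradField (u - v) x + gradField v x‖ ^ 2 :=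
        integral_congr_ae (hsub.mono fun x hx => by simp only [hx, Pi.sub_apply, sub_add_cancel])
    _ ≤ _ := integral_norm_add_sq_le ((hu2.sub hv2).ae_eq hsub.symm) hv2

/-- `v` coincides on the simplex `T` with a field whose components are polynomials of degree at
most `k`. -/
def IsPolyOn (k : ℕ) (T : Finset (Space d)) (v : Space d → Space d) : Prop :=
  ∃ w ∈ polyFieldSpace d k, Set.EqOn v w (simplex T)

lemma isPolyOn_of_mem_feSpace {cells : Finset (Finset (Space d))} (hv : v ∈ feSpace cells k)
    (hT : T ∈ cells) : IsPolyOn k T v := by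
  choose p hp hvp using hv.2 T hT
  refine ⟨polyField d p, polyField_mem_polyFieldSpace hp, fun x hx => ?_⟩
  ext i
  exact hvp i x hx

lemma IsPolyOn.differentiableAt (hv : IsPolyOn k T v) {x : Space d}
    (hx : x ∈ interior (simplex T)) : DifferentiableAt ℝ v x := by
  obtain ⟨w, hw, hvw⟩ := hv
  exact (differentiable_of_mem_polyFieldSpace hw x).congr_of_eventuallyEq
    (hvw.eventuallyEq_of_mem (mem_interior_iff_mem_nhds.mp hx))

lemma IsPolyOn.memLp_gradField (hv : IsPolyOn k T v) :
    MemLp (gradField v) 2 (volume.restrict (simplex T)) := by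
  obtain ⟨w, hw, hvw⟩ := hv
  exact (memLp_restrict_of_continuousOn (continuous_gradField hw).continuousOn
    (isCompact_simplex T) (measurableSet_simplex T) (isCompact_simplex T).measure_ne_top 2).ae_eq
    (gradField_eventuallyEq_restrict_simplex hvw).symm

lemma memLp_gradField_region {cells : Finset (Finset (Space d))} (hv : v ∈ feSpace cells k) :
    MemLp (gradField v) 2 (volume.restrict (region cells)) := by
  have hmeas (S : Set (Space d)) : AEStronglyMeasurable (gradField v) (volume.restrict S) :=
    ((gradColumns d).measurable.comp (measurable_fderiv ℝ v)).aestronglyMeasurable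
  rw [memLp_two_iff_integrable_sq_norm (hmeas _), ← IntegrableOn, region,
    integrableOn_finset_iUnion]
  exact fun T hT => (memLp_two_iff_integrable_sq_norm (hmeas _)).mp
    (isPolyOn_of_mem_feSpace hv hT).memLp_gradField

lemma ae_differentiableAt_of_mem_feSpace {cells : Finset (Finset (Space d))}
    (hv : v ∈ feSpace cells k) :
    ∀ᵐ x ∂volume.restrict (region cells), DifferentiableAt ℝ v x := by
  rw [ae_restrict_iff' (isCompact_region cells).measurableSet]
  filter_upwards [ae_mem_interior_of_mem_region cells] with x hx hxr
  obtain ⟨T, hT, hxT⟩ := hx hxr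
  exact (isPolyOn_of_mem_feSpace hv hT).differentiableAt hxT

lemma exists_norm_gradField_sq_le_dirichletForm (d k : ℕ) {σ : ℝ} (hσ : 0 < σ) :
    ∃ C : ℝ, 0 < C ∧ ∀ T : Finset (Space d), 0 < meshSize T →
      (∃ x, Metric.closedBall x (meshSize T / (2 * σ)) ⊆ simplex T) →
      ∀ w ∈ polyFieldSpace d k, ∀ y ∈ simplex T,
        meshSize T ^ d * ‖gradField w y‖ ^ 2 ≤ C * dirichletForm (simplex T) w w := by
  obtain ⟨C, hC, hinv⟩ := exists_pow_mul_norm_gradField_sq_le d k (r := (2 * σ)⁻¹) (by positivity)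
  refine ⟨C, hC, fun T hT ⟨a, ha⟩ w hw y hy => ?_⟩
  have haT : a ∈ simplex T := ha (Metric.mem_closedBall_self (by positivity))
  calc meshSize T ^ d * ‖gradField w y‖ ^ 2
      ≤ C * dirichletForm (Metric.closedBall a (meshSize T / (2 * σ))) w w := by
        rw [dirichletForm_self]
        exact hinv w hw a _ hT y (dist_le_meshSize hy haT)
    _ ≤ C * dirichletForm (simplex T) w w := by
        gcongr
        exact dirichletForm_mono ha.eventuallyLE (IsPolyOn.memLp_gradField ⟨w, hw, fun _ _ => rfl⟩)

lemma SimplicialMesh.fderivWithin_simplex_eq (M : SimplicialMesh d) (hT : T ∈ M.cells)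
    (hvw : Set.EqOn v w (simplex T)) {x : Space d} (hx : x ∈ simplex T)
    (hw : DifferentiableAt ℝ w x) : fderivWithin ℝ v (simplex T) x = fderiv ℝ w x := by
  rw [fderivWithin_congr hvw (hvw hx)]
  exact hw.fderivWithin (uniqueDiffOn_convex (convex_convexHull ℝ _)
    (M.interior_simplex_nonempty hT) x hx)

lemma exists_trace_inverse_inequality (d k : ℕ) (hd : 1 ≤ d) {σ : ℝ} (hσ : 0 < σ) :
    ∃ C : ℝ, 0 < C ∧ ∀ M : SimplicialMesh d, M.ShapeRegular σ → ∀ T ∈ M.cells,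
      ∀ v, IsPolyOn k T v → ∀ n : Space d → Space d, (∀ x, ‖n x‖ ≤ 1) →
      ∀ S ⊆ frontier (simplex T),
        meshSize T * ∫ x in S, ‖fderivWithin ℝ v (simplex T) x (n x)‖ ^ 2 ∂μHE[d - 1] ≤
          C * dirichletForm (simplex T) v v := by
  obtain ⟨C₁, hC₁, hinverse⟩ := exists_norm_gradField_sq_le_dirichletForm d k hσ
  obtain ⟨C₂, hC₂, hsurface⟩ := SimplicialMesh.exists_surfaceMeasure_frontier_simplex_le hd
  refine ⟨C₁ * C₂, by positivity, fun M hM T hT v ⟨w, hw, hvw⟩ n hn S hS => ?_⟩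
  have hh : 0 < meshSize T := M.meshSize_pos hd hT
  rw [dirichletForm_simplex_congr hvw]
  set h := meshSize T
  set D := dirichletForm (simplex T) w w
  have hSmeas : μHE[d - 1] S ≤ ENNReal.ofReal (C₂ * h ^ (d - 1)) :=
    (measure_mono hS).trans (hsurface M T hT)
  have hpoint (x) (hx : x ∈ S) :
      ‖‖fderivWithin ℝ v (simplex T) x (n x)‖ ^ 2‖ ≤ C₁ * D / h ^ d := by
    have hxT : x ∈ simplex T := (isCompact_simplex T).isClosed.frontier_subset (hS hx)
    rw [norm_pow, norm_norm, M.fderivWithin_simplex_eq hT hvw hxT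
      (differentiable_of_mem_polyFieldSpace hw x), le_div_iff₀ (by positivity), mul_comm]
    refine le_trans ?_ (hinverse T hh (hM T hT) w hw x hxT)
    gcongr
    exact (norm_apply_le_norm_gradColumns_mul _ _).trans
      (mul_le_of_le_one_right (norm_nonneg _) (hn x))
  calc h * ∫ x in S, ‖fderivWithin ℝ v (simplex T) x (n x)‖ ^ 2 ∂μHE[d - 1]
      ≤ h * (C₁ * D / h ^ d * (C₂ * h ^ (d - 1))) := by
        have hD : 0 ≤ D := dirichletForm_self_nonneg _ _
        refine mul_le_mul_of_nonneg_left (((le_abs_self _).trans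
          (norm_setIntegral_le_of_norm_le_const (hSmeas.trans_lt ENNReal.ofReal_lt_top)
            hpoint)).trans ?_) hh.le
        gcongr
        exact ENNReal.toReal_le_of_le_ofReal (by positivity) hSmeas
    _ = C₁ * C₂ * D * (h ^ (d - 1) * h) / h ^ d := by ring
    _ = C₁ * C₂ * D := by
        rw [← pow_succ, Nat.sub_add_cancel hd]
        field_simp

end Dirichlet

/-! ### The overlap region -/

section Region

variable {d : ℕ} {Ω₁ Ω₂ : Set (Space d)}

lemma closure_wholeDomain_subset (Ω₁ Ω₂ : Set (Space d)) :
    closure (wholeDomain Ω₁ Ω₂) ⊆ closure Ω₁ ∪ closure Ω₂ := by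
  rw [← closure_union]
  exact closure_minimal interior_subset isClosed_closure

namespace OverlappingMeshes

variable (M : OverlappingMeshes Ω₁ Ω₂) {T : Finset (Space d)}

lemma T₁star_subset : M.T₁star ⊆ M.T₀.cells := by
  classical exact Finset.filter_subset _ _

lemma region_T₁star_subset : region M.T₁star ⊆ closure Ω₁ ∪ closure Ω₂ := by
  refine Set.iUnion₂_subset fun T hT => ?_
  refine (simplex_subset_region (M.T₁star_subset hT)).trans ?_
  rw [M.region_T₀]
  exact closure_wholeDomain_subset Ω₁ Ω₂

lemma simplex_subset_closure_of_volume_inter_eq_zero (hΩ₂ : IsOpen Ω₂) (hT : T ∈ M.T₀.cells)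
    (hvol : volume (simplex T ∩ Ω₂) = 0) : simplex T ⊆ closure Ω₁ := by
  have hempty : interior (simplex T) ∩ Ω₂ = ∅ := by
    rw [← (isOpen_interior.inter hΩ₂).measure_eq_zero_iff volume]
    exact measure_mono_null (Set.inter_subset_inter_left _ interior_subset) hvol
  have hdisjoint : Disjoint (interior (simplex T)) (closure Ω₂) :=
    (Set.disjoint_iff_inter_eq_empty.mpr hempty).closure_right isOpen_interior
  have hinterior : interior (simplex T) ⊆ closure Ω₁ := fun y hy =>
    have hyΩ : y ∈ closure (wholeDomain Ω₁ Ω₂) :=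
      M.region_T₀ ▸ simplex_subset_region hT (interior_subset hy)
    (closure_wholeDomain_subset Ω₁ Ω₂ hyΩ).resolve_right (Set.disjoint_left.mp hdisjoint hy)
  have hclosure := (convex_convexHull ℝ
    (T : Set (Space d))).closure_interior_eq_closure_of_nonempty_interior
      (M.T₀.interior_simplex_nonempty hT)
  rw [(isCompact_simplex T).isClosed.closure_eq] at hclosure
  rw [← hclosure]
  exact closure_minimal hinterior isClosed_closure

lemma mem_T₁star_of_mem_interior (hΩ₁ : IsOpen Ω₁) (hΩ₂ : IsOpen Ω₂) (hT : T ∈ M.T₀.cells)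
    {x : Space d} (hx : x ∈ Ω₁) (hxT : x ∈ interior (simplex T)) : T ∈ M.T₁star := by
  classical
  refine Finset.mem_filter.mpr ⟨hT, ?_⟩
  by_cases hvol : volume (simplex T ∩ Ω₂) = 0
  · exact Or.inl (M.simplex_subset_closure_of_volume_inter_eq_zero hΩ₂ hT hvol)
  · have hpos : 0 < volume (interior (simplex T) ∩ Ω₁) :=
      (isOpen_interior.inter hΩ₁).measure_pos volume ⟨x, hxT, hx⟩
    exact Or.inr ⟨hpos.trans_le (measure_mono (Set.inter_subset_inter_left _ interior_subset)),
      pos_iff_ne_zero.mpr hvol⟩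

lemma subset_region_T₁star (hΩ₁ : IsOpen Ω₁) (hΩ₂ : IsOpen Ω₂) : Ω₁ ⊆ region M.T₁star := by
  have hnull : volume (Ω₁ \ region M.T₁star) = 0 := by
    rw [measure_eq_zero_iff_ae_notMem]
    filter_upwards [ae_mem_interior_of_mem_region M.T₀.cells] with x hx hxΩ
    have hxr : x ∈ region M.T₀.cells := by
      rw [M.region_T₀]
      exact subset_closure (interior_maximal (Set.subset_union_left.trans subset_closure)
        hΩ₁ hxΩ.1)
    obtain ⟨T, hT, hxT⟩ := hx hxr
    exact hxΩ.2 (simplex_subset_region (M.mem_T₁star_of_mem_interior hΩ₁ hΩ₂ hT hxΩ.1 hxT)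
      (interior_subset hxT))
  rwa [(hΩ₁.sdiff (isCompact_region _).isClosed).measure_eq_zero_iff volume,
    Set.sdiff_eq_empty] at hnull

lemma region_T₁star_ae_eq (hΩ : IsDecomposition Ω₁ Ω₂) :
    region M.T₁star =ᵐ[volume] (Ω₁ ∪ M.overlap : Set (Space d)) := by
  filter_upwards [(closure_ae_eq_of_null_frontier hΩ.null₁).mem_iff,
    (closure_ae_eq_of_null_frontier hΩ.null₂).mem_iff] with x hx₁ hx₂
  refine propext ⟨fun hx => ?_, fun hx => ?_⟩
  · exact (M.region_T₁star_subset hx).imp hx₁.mp fun hxc => ⟨hx₂.mp hxc, hx⟩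
  · exact hx.elim (fun hx => M.subset_region_T₁star hΩ.isOpen₁ hΩ.isOpen₂ hx) And.right

section Bulk

variable {M} {k : ℕ} {v : (Space d → Space d) × (Space d → Space d)}

lemma sum_dirichletForm_T₁star {v : Space d → Space d} (hv : v ∈ feSpace M.T₁star k) :
    ∑ T ∈ M.T₁star, dirichletForm (simplex T) v v = dirichletForm (region M.T₁star) v v := by
  simp only [dirichletForm_self]
  exact (M.T₀.integral_region M.T₁star_subset fun T hT =>
    (isPolyOn_of_mem_feSpace hv hT).memLp_gradField.integrable_norm_pow two_ne_zero).symm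

lemma sum_dirichletForm_T₂ (hΩ : IsDecomposition Ω₁ Ω₂) {v : Space d → Space d}
    (hv : v ∈ feSpace M.T₂.cells k) :
    ∑ T ∈ M.T₂.cells, dirichletForm (simplex T) v v = dirichletForm Ω₂ v v := by
  simp only [dirichletForm_self]
  rw [← setIntegral_congr_set (closure_ae_eq_of_null_frontier hΩ.null₂), ← M.region_T₂]
  exact (M.T₂.integral_region subset_rfl fun T hT =>
    (isPolyOn_of_mem_feSpace hv hT).memLp_gradField.integrable_norm_pow two_ne_zero).symm

lemma subset_region_T₂ : Ω₂ ⊆ region M.T₂.cells := M.region_T₂ ▸ subset_closure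

variable (hv : v ∈ M.velocitySpace k)
include hv

lemma memLp_gradField_fst (hΩ₁ : IsOpen Ω₁) (hΩ₂ : IsOpen Ω₂) :
    MemLp (gradField v.1) 2 (volume.restrict Ω₁) :=
  (memLp_gradField_region hv.1).mono_measure
    (Measure.restrict_mono_set _ (M.subset_region_T₁star hΩ₁ hΩ₂))

lemma memLp_gradField_snd : MemLp (gradField v.2) 2 (volume.restrict Ω₂) :=
  (memLp_gradField_region hv.2).mono_measure (Measure.restrict_mono_set _ subset_region_T₂)

lemma dirichletForm_overlap_snd_le :
    dirichletForm M.overlap v.2 v.2 ≤ dirichletForm Ω₂ v.2 v.2 :=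
  dirichletForm_mono Set.inter_subset_left.eventuallyLE (memLp_gradField_snd hv)

lemma ae_overlap_differentiableAt_fst :
    ∀ᵐ x ∂volume.restrict M.overlap, DifferentiableAt ℝ v.1 x :=
  ae_restrict_of_ae_restrict_of_subset Set.inter_subset_right
    (ae_differentiableAt_of_mem_feSpace hv.1)

lemma ae_overlap_differentiableAt_snd :
    ∀ᵐ x ∂volume.restrict M.overlap, DifferentiableAt ℝ v.2 x :=
  ae_restrict_of_ae_restrict_of_subset (Set.inter_subset_left.trans subset_region_T₂)
    (ae_differentiableAt_of_mem_feSpace hv.2)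

lemma memLp_overlap_gradField_fst : MemLp (gradField v.1) 2 (volume.restrict M.overlap) :=
  (memLp_gradField_region hv.1).mono_measure (Measure.restrict_mono_set _ Set.inter_subset_right)

lemma memLp_overlap_gradField_snd : MemLp (gradField v.2) 2 (volume.restrict M.overlap) :=
  (memLp_gradField_snd hv).mono_measure (Measure.restrict_mono_set _ Set.inter_subset_left)

lemma memLp_overlap_gradField_sub :
    MemLp (gradField (v.1 - v.2)) 2 (volume.restrict M.overlap) :=
  ((memLp_overlap_gradField_fst hv).sub (memLp_overlap_gradField_snd hv)).ae_eq
    (gradField_sub_ae_eq (ae_overlap_differentiableAt_fst hv)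
      (ae_overlap_differentiableAt_snd hv)).symm

lemma s_self_le : M.s v v ≤
    2 * dirichletForm (region M.T₁star) v.1 v.1 + 2 * dirichletForm Ω₂ v.2 v.2 := by
  have hfst : dirichletForm M.overlap v.1 v.1 ≤ dirichletForm (region M.T₁star) v.1 v.1 :=
    dirichletForm_mono Set.inter_subset_right.eventuallyLE (memLp_gradField_region hv.1)
  have hsub : M.s v v ≤ 2 * dirichletForm M.overlap v.1 v.1 +
      2 * dirichletForm M.overlap v.2 v.2 :=
    dirichletForm_sub_le (ae_overlap_differentiableAt_fst hv) (ae_overlap_differentiableAt_snd hv)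
      (memLp_overlap_gradField_fst hv) (memLp_overlap_gradField_snd hv)
  linarith [dirichletForm_overlap_snd_le hv]

lemma dirichletForm_region_T₁star_le (hΩ : IsDecomposition Ω₁ Ω₂) :
    dirichletForm (region M.T₁star) v.1 v.1 ≤
      dirichletForm Ω₁ v.1 v.1 + 2 * M.s v v + 2 * dirichletForm Ω₂ v.2 v.2 := by
  have hsplit : dirichletForm (region M.T₁star) v.1 v.1 =
      dirichletForm Ω₁ v.1 v.1 + dirichletForm M.overlap v.1 v.1 := by
    have hint := (memLp_gradField_region hv.1).integrable_norm_pow two_ne_zero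
    simp only [dirichletForm_self]
    rw [setIntegral_congr_set (M.region_T₁star_ae_eq hΩ)]
    exact setIntegral_union (hΩ.disjoint.mono_right Set.inter_subset_left)
      (hΩ.isOpen₂.measurableSet.inter (isCompact_region _).measurableSet)
      (IntegrableOn.mono_set hint (M.subset_region_T₁star hΩ.isOpen₁ hΩ.isOpen₂))
      (IntegrableOn.mono_set hint Set.inter_subset_right)
  have hsub : dirichletForm M.overlap v.1 v.1 ≤
      2 * M.s v v + 2 * dirichletForm M.overlap v.2 v.2 :=
    dirichletForm_le_add_sub (ae_overlap_differentiableAt_fst hv)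
      (ae_overlap_differentiableAt_snd hv) (memLp_overlap_gradField_fst hv)
      (memLp_overlap_gradField_snd hv)
  linarith [dirichletForm_overlap_snd_le hv]

end Bulk

end OverlappingMeshes

end Region

/-! ### Measurability of the outer normal -/

section OuterNormal

open Filter Topology

variable {d : ℕ} {S : Set (Space d)} {x y n m : Space d}

lemma IsOuterNormal.mem (hn : IsOuterNormal S x n) : x ∈ S := by
  obtain ⟨-, r, hr, hS⟩ := hn
  simp [hS x (Metric.mem_ball_self hr)]

lemma IsOuterNormal.eventually_mem_iff (hn : IsOuterNormal S x n) (v : Space d) :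
    ∀ᶠ t : ℝ in 𝓝[>] 0, x + t • v ∈ S ↔ inner ℝ v n ≤ 0 := by
  obtain ⟨-, r, hr, hS⟩ := hn
  have hline : Tendsto (fun t : ℝ => x + t • v) (𝓝[>] 0) (𝓝 x) :=
    (Continuous.tendsto' (by fun_prop) 0 x (by simp)).mono_left nhdsWithin_le_nhds
  filter_upwards [hline (Metric.ball_mem_nhds x hr), self_mem_nhdsWithin] with t ht htpos
  rw [hS _ ht, add_sub_cancel_left, real_inner_smul_left, ← smul_eq_mul,
    smul_nonpos_iff_nonpos_of_pos_left htpos]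

lemma IsOuterNormal.inner_nonpos_iff (hn : IsOuterNormal S x n) (hm : IsOuterNormal S x m)
    (v : Space d) : inner ℝ v n ≤ 0 ↔ inner ℝ v m ≤ 0 := by
  obtain ⟨t, htn, htm⟩ := ((hn.eventually_mem_iff v).and (hm.eventually_mem_iff v)).exists
  exact htn.symm.trans htm

lemma IsOuterNormal.unique (hn : IsOuterNormal S x n) (hm : IsOuterNormal S x m) : n = m := by
  have hle : inner ℝ m n ≤ 1 := by simpa [hn.1, hm.1] using real_inner_le_norm m n
  have hdiff : inner ℝ (m - n) m ≤ 0 := by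
    rw [← hn.inner_nonpos_iff hm, inner_sub_left, real_inner_self_eq_norm_sq, hn.1]
    linarith
  rw [inner_sub_left, real_inner_self_eq_norm_sq, hm.1] at hdiff
  have hge : 1 ≤ inner ℝ n m := by linarith
  exact (inner_eq_one_iff_of_norm_eq_one (𝕜 := ℝ) hn.1 hm.1).mp
    (le_antisymm (by rwa [real_inner_comm]) hge)

lemma IsOuterNormal.notMem_interior (hn : IsOuterNormal S x n) : x ∉ interior S := by
  intro hx
  have hline : Tendsto (fun t : ℝ => x + t • n) (𝓝[>] 0) (𝓝 x) :=
    (Continuous.tendsto' (by fun_prop) 0 x (by simp)).mono_left nhdsWithin_le_nhds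
  obtain ⟨t, ht, htS⟩ := ((hn.eventually_mem_iff n).and
    (hline (mem_interior_iff_mem_nhds.mp hx))).exists
  have hnn := ht.mp htS
  rw [real_inner_self_eq_norm_sq, hn.1] at hnn
  linarith

lemma IsOuterNormal.eventually_isOuterNormal_iff (hn : IsOuterNormal S x n) :
    ∀ᶠ y in 𝓝 x, ∀ m, IsOuterNormal S y m ↔ m = n ∧ inner ℝ (y - x) n = 0 := by
  obtain ⟨hn1, r, hr, hS⟩ := hn
  filter_upwards [Metric.ball_mem_nhds x hr] with y hy m
  have hyr : ∀ᶠ z in 𝓝 y, z ∈ S ↔ inner ℝ (z - x) n ≤ 0 :=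
    eventually_of_mem (Metric.isOpen_ball.mem_nhds hy) hS
  have hflat (hyn : inner ℝ (y - x) n = 0) : IsOuterNormal S y n := by
    refine ⟨hn1, Metric.eventually_nhds_iff_ball.mp (hyr.mono fun z hz => ?_)⟩
    rw [hz, ← sub_add_sub_cancel z y x, inner_add_left, hyn, add_zero]
  refine ⟨fun hm => ?_, fun h => h.1 ▸ hflat h.2⟩
  have hyn : inner ℝ (y - x) n = 0 := by
    refine le_antisymm ((hS y hy).mp hm.mem) (not_lt.mp fun hlt => hm.notMem_interior ?_)
    have hopen : IsOpen {z : Space d | inner ℝ (z - x) n < 0} :=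
      isOpen_lt (by fun_prop) continuous_const
    rw [mem_interior_iff_mem_nhds]
    filter_upwards [hyr, hopen.mem_nhds hlt] with z hz hzn
    exact hz.mpr hzn.le
  exact ⟨hm.unique (hflat hyn), hyn⟩

lemma outerNormal_eq (hn : IsOuterNormal S x n) : outerNormal S x = n := by
  have hex : ∃ n, IsOuterNormal S x n := ⟨n, hn⟩
  rw [outerNormal, dif_pos hex]
  exact hex.choose_spec.unique hn

lemma outerNormal_eq_zero (hx : ¬∃ n, IsOuterNormal S x n) : outerNormal S x = 0 :=
  dif_neg hx

lemma norm_outerNormal_le_one (S : Set (Space d)) (x : Space d) : ‖outerNormal S x‖ ≤ 1 := by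
  by_cases hx : ∃ n, IsOuterNormal S x n
  · obtain ⟨n, hn⟩ := hx
    rw [outerNormal_eq hn, hn.1]
  · rw [outerNormal_eq_zero hx, norm_zero]
    exact zero_le_one

lemma isLocallyClosed_setOf_isOuterNormal (S : Set (Space d)) :
    IsLocallyClosed {x | ∃ n, IsOuterNormal S x n} := by
  refine ((isLocallyClosed_tfae _).out 0 3).mpr ?_
  rintro x ⟨n, hn⟩
  obtain ⟨U, hUn, hU, hxU⟩ := eventually_nhds_iff.mp hn.eventually_isOuterNormal_iff
  refine ⟨U, hxU, hU, fun y ⟨hyU, hyF⟩ => ⟨n, (hUn y hyU n).mpr ⟨rfl, ?_⟩⟩⟩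
  have hplane : IsClosed {z : Space d | inner ℝ (z - x) n = 0} :=
    isClosed_eq (by fun_prop) continuous_const
  exact closure_minimal (fun z hz => hz.2.elim fun m hm => ((hUn z hz.1 m).mp hm).2) hplane
    (hU.inter_closure ⟨hyU, hyF⟩)

lemma measurable_outerNormal (S : Set (Space d)) : Measurable (outerNormal S) := by
  classical
  set F : Set (Space d) := {x | ∃ n, IsOuterNormal S x n}
  have hF : MeasurableSet F := by
    obtain ⟨U, Z, hU, hZ, hUZ⟩ := isLocallyClosed_setOf_isOuterNormal S
    rw [show F = U ∩ Z from hUZ]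
    exact hU.measurableSet.inter hZ.measurableSet
  have hcont : ContinuousOn (outerNormal S) F := by
    rintro x ⟨n, hn⟩
    refine continuousWithinAt_const.congr_of_eventuallyEq (f := fun _ => n) ?_ (outerNormal_eq hn)
    filter_upwards [self_mem_nhdsWithin,
      mem_nhdsWithin_of_mem_nhds hn.eventually_isOuterNormal_iff] with y ⟨m, hm⟩ hy
    rw [outerNormal_eq hm, ((hy m).mp hm).1]
  have hpiecewise : outerNormal S = F.piecewise (outerNormal S) 0 := by
    ext1 x
    by_cases hx : x ∈ F
    · rw [Set.piecewise_eq_of_mem _ _ _ hx]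
    · rw [Set.piecewise_eq_of_notMem _ _ _ hx, outerNormal_eq_zero hx, Pi.zero_apply]
  rw [hpiecewise]
  exact hcont.measurable_piecewise continuousOn_const hF

end OuterNormal

/-! ### Discrete trace inequality -/

namespace OverlappingMeshes

section Interface

variable {d k : ℕ} {Ω₁ Ω₂ : Set (Space d)} (M : OverlappingMeshes Ω₁ Ω₂) {T : Finset (Space d)}
  {f g : Finset (Space d) → Space d → Space d} {v : (Space d → Space d) × (Space d → Space d)}

lemma isCompact_interface_inter_simplex (Ω₁ Ω₂ : Set (Space d)) (T : Finset (Space d)) :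
    IsCompact (interface Ω₁ Ω₂ ∩ simplex T) :=
  (isCompact_simplex T).inter_left (isClosed_frontier.inter isClosed_frontier)

lemma interface_inter_simplex_subset_frontier (hT : T ∈ M.T₂.cells) :
    interface Ω₁ Ω₂ ∩ simplex T ⊆ frontier (simplex T) := fun _ ⟨⟨_, hxΩ₂⟩, hxT⟩ =>
  ⟨subset_closure hxT, fun hx => hxΩ₂.2 (interior_mono (M.region_T₂ ▸ simplex_subset_region hT) hx)⟩

lemma surfaceMeasure_interface_inter_simplex_ne_top (hd : 1 ≤ d) (hT : T ∈ M.T₂.cells) :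
    μHE[d - 1] (interface Ω₁ Ω₂ ∩ simplex T) ≠ ⊤ := by
  obtain ⟨C, -, hC⟩ := SimplicialMesh.exists_surfaceMeasure_frontier_simplex_le hd
  exact (((measure_mono (M.interface_inter_simplex_subset_frontier hT)).trans
    (hC M.T₂ T hT)).trans_lt ENNReal.ofReal_lt_top).ne

lemma interfaceNormSq_nonneg (α : ℝ) (f : Finset (Space d) → Space d → Space d) :
    0 ≤ M.interfaceNormSq α f :=
  Finset.sum_nonneg fun T _ => mul_nonneg (Real.rpow_nonneg (meshSize_nonneg T) _)
    (integral_nonneg fun _ => sq_nonneg _)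

lemma interfaceNormSq_neg_half (f : Finset (Space d) → Space d → Space d) :
    M.interfaceNormSq (-1 / 2) f = ∑ T ∈ M.T₂.cells, meshSize T *
      ∫ x in interface Ω₁ Ω₂ ∩ simplex T, ‖f T x‖ ^ 2 ∂μHE[d - 1] := by
  refine Finset.sum_congr rfl fun T _ => ?_
  norm_num

lemma interfaceNormSq_half (f : Finset (Space d) → Space d → Space d) :
    M.interfaceNormSq (1 / 2) f = ∑ T ∈ M.T₂.cells, (meshSize T)⁻¹ *
      ∫ x in interface Ω₁ Ω₂ ∩ simplex T, ‖f T x‖ ^ 2 ∂μHE[d - 1] := by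
  refine Finset.sum_congr rfl fun T _ => ?_
  rw [← Real.rpow_neg_one]
  norm_num

lemma interfaceNormSq_inv_meshSize_smul (hd : 1 ≤ d) (f : Finset (Space d) → Space d → Space d) :
    M.interfaceNormSq (-1 / 2) (fun T x => (meshSize T)⁻¹ • f T x) =
      M.interfaceNormSq (1 / 2) f := by
  rw [interfaceNormSq_neg_half, interfaceNormSq_half]
  refine Finset.sum_congr rfl fun T hT => ?_
  have hh : 0 < meshSize T := M.T₂.meshSize_pos hd hT
  simp only [norm_smul, mul_pow, integral_const_mul, norm_inv, Real.norm_of_nonneg hh.le]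
  field_simp

lemma interfaceInner_inv_meshSize_smul_self (f : Finset (Space d) → Space d → Space d) :
    M.interfaceInner (fun T x => (meshSize T)⁻¹ • f T x) f = M.interfaceNormSq (1 / 2) f := by
  rw [interfaceNormSq_half]
  refine Finset.sum_congr rfl fun T _ => ?_
  simp only [real_inner_smul_left, real_inner_self_eq_norm_sq, integral_const_mul]

/-- Square integrability on the interface with respect to the surface measure, for fields given
element by element of the mesh `T₂`. -/
def InterfaceSqIntegrable (f : Finset (Space d) → Space d → Space d) : Prop :=
  ∀ T ∈ M.T₂.cells, MemLp (f T) 2 (μHE[d - 1].restrict (interface Ω₁ Ω₂ ∩ simplex T))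

variable {M}

lemma InterfaceSqIntegrable.abs_interfaceInner_le (hf : M.InterfaceSqIntegrable f)
    (hg : M.InterfaceSqIntegrable g) (hd : 1 ≤ d) : |M.interfaceInner f g| ≤
      √(M.interfaceNormSq (-1 / 2) f) * √(M.interfaceNormSq (1 / 2) g) := by
  rw [interfaceNormSq_neg_half, interfaceNormSq_half]
  have hnonneg (f : Finset (Space d) → Space d → Space d) (T) :
      0 ≤ ∫ x in interface Ω₁ Ω₂ ∩ simplex T, ‖f T x‖ ^ 2 ∂μHE[d - 1] :=
    integral_nonneg fun _ => sq_nonneg _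
  calc |M.interfaceInner f g|
      ≤ ∑ T ∈ M.T₂.cells, √(∫ x in interface Ω₁ Ω₂ ∩ simplex T, ‖f T x‖ ^ 2 ∂μHE[d - 1]) *
          √(∫ x in interface Ω₁ Ω₂ ∩ simplex T, ‖g T x‖ ^ 2 ∂μHE[d - 1]) :=
        (Finset.abs_sum_le_sum_abs _ _).trans (Finset.sum_le_sum fun T hT =>
          abs_integral_inner_le_sqrt_mul_sqrt (hf T hT) (hg T hT))
    _ = ∑ T ∈ M.T₂.cells,
          √(meshSize T * ∫ x in interface Ω₁ Ω₂ ∩ simplex T, ‖f T x‖ ^ 2 ∂μHE[d - 1]) *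
          √((meshSize T)⁻¹ * ∫ x in interface Ω₁ Ω₂ ∩ simplex T, ‖g T x‖ ^ 2 ∂μHE[d - 1]) := by
        refine Finset.sum_congr rfl fun T hT => ?_
        have hh : 0 < meshSize T := M.T₂.meshSize_pos hd hT
        rw [← Real.sqrt_mul (hnonneg f T),
          ← Real.sqrt_mul (mul_nonneg hh.le (hnonneg f T))]
        field_simp
    _ ≤ _ := Real.sum_sqrt_mul_sqrt_le _
        (fun T => mul_nonneg (meshSize_nonneg T) (hnonneg f T))
        (fun T => mul_nonneg (inv_nonneg.mpr (meshSize_nonneg T)) (hnonneg g T))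

lemma InterfaceSqIntegrable.inv_meshSize_smul (hf : M.InterfaceSqIntegrable f) :
    M.InterfaceSqIntegrable fun T x => (meshSize T)⁻¹ • f T x :=
  fun T hT => (hf T hT).const_smul (meshSize T)⁻¹

lemma interfaceSqIntegrable_jump (hd : 1 ≤ d) (hΩ₁ : IsOpen Ω₁) (hΩ₂ : IsOpen Ω₂)
    (hv : v ∈ M.velocitySpace k) : M.InterfaceSqIntegrable (jump v) := by
  intro T hT
  have hclosure : closure Ω₁ ⊆ region M.T₁star :=
    closure_minimal (M.subset_region_T₁star hΩ₁ hΩ₂) (isCompact_region _).isClosed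
  have hfst : ContinuousOn v.1 (interface Ω₁ Ω₂ ∩ simplex T) :=
    hv.1.1.mono fun x hx => hclosure (isClosed_closure.frontier_subset hx.1.1)
  have hsnd : ContinuousOn v.2 (interface Ω₁ Ω₂ ∩ simplex T) :=
    hv.2.1.mono fun x hx => simplex_subset_region hT hx.2
  have hK := isCompact_interface_inter_simplex Ω₁ Ω₂ T
  exact memLp_restrict_of_continuousOn (hsnd.sub hfst) hK hK.measurableSet
    (M.surfaceMeasure_interface_inter_simplex_ne_top hd hT) 2

lemma interfaceSqIntegrable_meanFlux (hd : 1 ≤ d) (hv : v ∈ M.velocitySpace k) :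
    M.InterfaceSqIntegrable (M.meanFlux v) := by
  intro T hT
  obtain ⟨w, hw, hvw⟩ := isPolyOn_of_mem_feSpace hv.2 hT
  have hK := isCompact_interface_inter_simplex Ω₁ Ω₂ T
  have hflux : Set.EqOn (fun x => fderiv ℝ w x (outerNormal (closure Ω₂) x)) (M.meanFlux v T)
      (interface Ω₁ Ω₂ ∩ simplex T) := fun x hx => by
    rw [meanFlux, M.T₂.fderivWithin_simplex_eq hT hvw hx.2
      (differentiable_of_mem_polyFieldSpace hw x)]
  have hmeas : Measurable fun x => fderiv ℝ w x (outerNormal (closure Ω₂) x) :=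
    isBoundedBilinearMap_apply.continuous.measurable.comp
      ((measurable_fderiv ℝ w).prodMk (measurable_outerNormal _))
  have hgrad : MemLp (gradField w) 2 (μHE[d - 1].restrict (interface Ω₁ Ω₂ ∩ simplex T)) :=
    memLp_restrict_of_continuousOn (continuous_gradField hw).continuousOn hK hK.measurableSet
      (M.surfaceMeasure_interface_inter_simplex_ne_top hd hT) 2
  refine (hgrad.of_le hmeas.aestronglyMeasurable (ae_of_all _ fun x => ?_)).ae_eq
    (ae_restrict_of_forall_mem hK.measurableSet hflux)
  exact (norm_apply_le_norm_gradColumns_mul _ _).trans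
    (mul_le_of_le_one_right (norm_nonneg _) (norm_outerNormal_le_one _ x))

lemma exists_interfaceNormSq_meanFlux_le (d k : ℕ) (hd : 1 ≤ d) {σ : ℝ} (hσ : 0 < σ) :
    ∃ C : ℝ, 0 < C ∧ ∀ Ω₁ Ω₂ : Set (Space d), IsDecomposition Ω₁ Ω₂ →
      ∀ M : OverlappingMeshes Ω₁ Ω₂, M.T₂.ShapeRegular σ → ∀ v ∈ M.velocitySpace k,
        M.interfaceNormSq (-1 / 2) (M.meanFlux v) ≤ C * dirichletForm Ω₂ v.2 v.2 := by
  obtain ⟨C, hC, htrace⟩ := exists_trace_inverse_inequality d k hd hσ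
  refine ⟨C, hC, fun Ω₁ Ω₂ hΩ M hM v hv => ?_⟩
  rw [interfaceNormSq_neg_half, ← sum_dirichletForm_T₂ hΩ hv.2, Finset.mul_sum]
  exact Finset.sum_le_sum fun T hT => htrace M.T₂ hM T hT v.2 (isPolyOn_of_mem_feSpace hv.2 hT) _
    (norm_outerNormal_le_one _) _ (M.interface_inter_simplex_subset_frontier hT)

end Interface

end OverlappingMeshes

/-! ### Continuity and coercivity -/

namespace OverlappingMeshes

section Nitsche

variable {d k : ℕ} {Ω₁ Ω₂ : Set (Space d)} {M : OverlappingMeshes Ω₁ Ω₂}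
  {u v : (Space d → Space d) × (Space d → Space d)}

lemma starNorm_nonneg (v : (Space d → Space d) × (Space d → Space d)) : 0 ≤ M.starNorm v :=
  Real.sqrt_nonneg _

lemma starNorm_sq (hΩ : IsDecomposition Ω₁ Ω₂) (hv : v ∈ M.velocitySpace k) :
    M.starNorm v ^ 2 = dirichletForm (region M.T₁star) v.1 v.1 + dirichletForm Ω₂ v.2 v.2
      + M.interfaceNormSq (-1 / 2) (M.meanFlux v) + M.interfaceNormSq (1 / 2) (jump v) := by
  rw [starNorm, sum_dirichletForm_T₁star hv.1, sum_dirichletForm_T₂ hΩ hv.2, Real.sq_sqrt]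
  exact add_nonneg (add_nonneg (add_nonneg (dirichletForm_self_nonneg _ _)
    (dirichletForm_self_nonneg _ _)) (M.interfaceNormSq_nonneg _ _)) (M.interfaceNormSq_nonneg _ _)

lemma dirichletForm_add_dirichletForm_le_starNorm_sq (hΩ : IsDecomposition Ω₁ Ω₂)
    (hv : v ∈ M.velocitySpace k) :
    dirichletForm (region M.T₁star) v.1 v.1 + dirichletForm Ω₂ v.2 v.2 ≤ M.starNorm v ^ 2 := by
  rw [starNorm_sq hΩ hv, add_assoc _ (M.interfaceNormSq _ _)]
  exact le_add_of_nonneg_right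
    (add_nonneg (M.interfaceNormSq_nonneg _ _) (M.interfaceNormSq_nonneg _ _))

lemma sqrt_interfaceNormSq_meanFlux_le_starNorm (hΩ : IsDecomposition Ω₁ Ω₂)
    (hv : v ∈ M.velocitySpace k) :
    √(M.interfaceNormSq (-1 / 2) (M.meanFlux v)) ≤ M.starNorm v := by
  rw [Real.sqrt_le_left (starNorm_nonneg v), starNorm_sq hΩ hv]
  linarith [dirichletForm_self_nonneg (region M.T₁star) v.1, dirichletForm_self_nonneg Ω₂ v.2,
    M.interfaceNormSq_nonneg (1 / 2) (jump v)]

lemma sqrt_interfaceNormSq_jump_le_starNorm (hΩ : IsDecomposition Ω₁ Ω₂)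
    (hv : v ∈ M.velocitySpace k) :
    √(M.interfaceNormSq (1 / 2) (jump v)) ≤ M.starNorm v := by
  rw [Real.sqrt_le_left (starNorm_nonneg v), starNorm_sq hΩ hv]
  linarith [dirichletForm_self_nonneg (region M.T₁star) v.1, dirichletForm_self_nonneg Ω₂ v.2,
    M.interfaceNormSq_nonneg (-1 / 2) (M.meanFlux v)]

lemma sqrt_dirichletForm_fst_le_starNorm (hΩ : IsDecomposition Ω₁ Ω₂)
    (hv : v ∈ M.velocitySpace k) : √(dirichletForm Ω₁ v.1 v.1) ≤ M.starNorm v := by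
  have hmono : dirichletForm Ω₁ v.1 v.1 ≤ dirichletForm (region M.T₁star) v.1 v.1 :=
    dirichletForm_mono (M.subset_region_T₁star hΩ.isOpen₁ hΩ.isOpen₂).eventuallyLE
      (memLp_gradField_region hv.1)
  rw [Real.sqrt_le_left (starNorm_nonneg v)]
  linarith [dirichletForm_add_dirichletForm_le_starNorm_sq hΩ hv, dirichletForm_self_nonneg Ω₂ v.2]

lemma sqrt_dirichletForm_snd_le_starNorm (hΩ : IsDecomposition Ω₁ Ω₂)
    (hv : v ∈ M.velocitySpace k) : √(dirichletForm Ω₂ v.2 v.2) ≤ M.starNorm v := by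
  rw [Real.sqrt_le_left (starNorm_nonneg v)]
  linarith [dirichletForm_add_dirichletForm_le_starNorm_sq hΩ hv,
    dirichletForm_self_nonneg (region M.T₁star) v.1]

lemma sqrt_s_le_starNorm (hΩ : IsDecomposition Ω₁ Ω₂) (hv : v ∈ M.velocitySpace k) :
    √(M.s v v) ≤ √2 * M.starNorm v := by
  rw [Real.sqrt_le_left (mul_nonneg (Real.sqrt_nonneg 2) (starNorm_nonneg v)), mul_pow,
    Real.sq_sqrt zero_le_two]
  linarith [s_self_le hv, dirichletForm_add_dirichletForm_le_starNorm_sq hΩ hv]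

lemma abs_dirichletForm_fst_le (hΩ : IsDecomposition Ω₁ Ω₂) (hu : u ∈ M.velocitySpace k)
    (hv : v ∈ M.velocitySpace k) :
    |dirichletForm Ω₁ u.1 v.1| ≤ M.starNorm u * M.starNorm v :=
  (abs_dirichletForm_le (memLp_gradField_fst hu hΩ.isOpen₁ hΩ.isOpen₂)
    (memLp_gradField_fst hv hΩ.isOpen₁ hΩ.isOpen₂)).trans
    (mul_le_mul (sqrt_dirichletForm_fst_le_starNorm hΩ hu)
      (sqrt_dirichletForm_fst_le_starNorm hΩ hv) (Real.sqrt_nonneg _) (starNorm_nonneg u))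

lemma abs_dirichletForm_snd_le (hΩ : IsDecomposition Ω₁ Ω₂) (hu : u ∈ M.velocitySpace k)
    (hv : v ∈ M.velocitySpace k) :
    |dirichletForm Ω₂ u.2 v.2| ≤ M.starNorm u * M.starNorm v :=
  (abs_dirichletForm_le (memLp_gradField_snd hu) (memLp_gradField_snd hv)).trans
    (mul_le_mul (sqrt_dirichletForm_snd_le_starNorm hΩ hu)
      (sqrt_dirichletForm_snd_le_starNorm hΩ hv) (Real.sqrt_nonneg _) (starNorm_nonneg u))

lemma abs_s_le (hΩ : IsDecomposition Ω₁ Ω₂) (hu : u ∈ M.velocitySpace k)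
    (hv : v ∈ M.velocitySpace k) : |M.s u v| ≤ 2 * (M.starNorm u * M.starNorm v) :=
  calc |M.s u v| ≤ √(M.s u u) * √(M.s v v) :=
        abs_dirichletForm_le (memLp_overlap_gradField_sub hu) (memLp_overlap_gradField_sub hv)
    _ ≤ (√2 * M.starNorm u) * (√2 * M.starNorm v) :=
        mul_le_mul (sqrt_s_le_starNorm hΩ hu) (sqrt_s_le_starNorm hΩ hv) (Real.sqrt_nonneg _)
          (mul_nonneg (Real.sqrt_nonneg 2) (starNorm_nonneg u))
    _ = 2 * (M.starNorm u * M.starNorm v) := by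
        rw [mul_mul_mul_comm, Real.mul_self_sqrt zero_le_two]

lemma abs_interfaceInner_meanFlux_jump_le (hd : 1 ≤ d) (hΩ : IsDecomposition Ω₁ Ω₂)
    (hu : u ∈ M.velocitySpace k) (hv : v ∈ M.velocitySpace k) :
    |M.interfaceInner (M.meanFlux u) (jump v)| ≤ M.starNorm u * M.starNorm v :=
  ((interfaceSqIntegrable_meanFlux hd hu).abs_interfaceInner_le
    (interfaceSqIntegrable_jump hd hΩ.isOpen₁ hΩ.isOpen₂ hv) hd).trans
    (mul_le_mul (sqrt_interfaceNormSq_meanFlux_le_starNorm hΩ hu)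
      (sqrt_interfaceNormSq_jump_le_starNorm hΩ hv) (Real.sqrt_nonneg _) (starNorm_nonneg u))

lemma abs_interfaceInner_inv_meshSize_smul_jump_le (hd : 1 ≤ d) (hΩ : IsDecomposition Ω₁ Ω₂)
    (hu : u ∈ M.velocitySpace k) (hv : v ∈ M.velocitySpace k) :
    |M.interfaceInner (fun T x => (meshSize T)⁻¹ • jump u T x) (jump v)| ≤
      M.starNorm u * M.starNorm v := by
  have hjump {w} (hw : w ∈ M.velocitySpace k) : M.InterfaceSqIntegrable (jump w) :=
    interfaceSqIntegrable_jump hd hΩ.isOpen₁ hΩ.isOpen₂ hw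
  refine ((hjump hu).inv_meshSize_smul.abs_interfaceInner_le (hjump hv) hd).trans ?_
  rw [M.interfaceNormSq_inv_meshSize_smul hd]
  exact mul_le_mul (sqrt_interfaceNormSq_jump_le_starNorm hΩ hu)
    (sqrt_interfaceNormSq_jump_le_starNorm hΩ hv) (Real.sqrt_nonneg _) (starNorm_nonneg u)

theorem a_add_s_le (hd : 1 ≤ d) (hΩ : IsDecomposition Ω₁ Ω₂) {γ : ℝ} (hγ : 0 ≤ γ)
    (hu : u ∈ M.velocitySpace k) (hv : v ∈ M.velocitySpace k) :
    M.a γ u v + M.s u v ≤ (6 + γ) * M.starNorm u * M.starNorm v := by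
  have hfst := le_of_abs_le (abs_dirichletForm_fst_le hΩ hu hv)
  have hsnd := le_of_abs_le (abs_dirichletForm_snd_le hΩ hu hv)
  have hflux_u := neg_le_of_abs_le (abs_interfaceInner_meanFlux_jump_le hd hΩ hu hv)
  have hflux_v := neg_le_of_abs_le (abs_interfaceInner_meanFlux_jump_le hd hΩ hv hu)
  have hpenalty := mul_le_mul_of_nonneg_left
    (le_of_abs_le (abs_interfaceInner_inv_meshSize_smul_jump_le hd hΩ hu hv)) hγ
  have hoverlap := le_of_abs_le (abs_s_le hΩ hu hv)
  rw [a]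
  linarith

lemma two_mul_abs_interfaceInner_meanFlux_jump_le (hd : 1 ≤ d) (hΩ₁ : IsOpen Ω₁)
    (hΩ₂ : IsOpen Ω₂) {C : ℝ} (hC : 0 ≤ C) (hv : v ∈ M.velocitySpace k)
    (htrace : M.interfaceNormSq (-1 / 2) (M.meanFlux v) ≤ C * dirichletForm Ω₂ v.2 v.2) :
    2 * |M.interfaceInner (M.meanFlux v) (jump v)| ≤
      dirichletForm Ω₂ v.2 v.2 / 2 + 2 * C * M.interfaceNormSq (1 / 2) (jump v) := by
  set D := dirichletForm Ω₂ v.2 v.2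
  set F := M.interfaceNormSq (-1 / 2) (M.meanFlux v)
  set J := M.interfaceNormSq (1 / 2) (jump v)
  set I := M.interfaceInner (M.meanFlux v) (jump v)
  have hD : 0 ≤ D := dirichletForm_self_nonneg _ _
  have hF : 0 ≤ F := M.interfaceNormSq_nonneg _ _
  have hJ : 0 ≤ J := M.interfaceNormSq_nonneg _ _
  have hcauchy : |I| ≤ √F * √J := (interfaceSqIntegrable_meanFlux hd hv).abs_interfaceInner_le
    (interfaceSqIntegrable_jump hd hΩ₁ hΩ₂ hv) hd
  refine le_of_sq_le_sq ?_ (by positivity)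
  calc (2 * |I|) ^ 2 ≤ (2 * (√F * √J)) ^ 2 := by gcongr
    _ = 4 * F * J := by rw [mul_pow, mul_pow, Real.sq_sqrt hF, Real.sq_sqrt hJ]; ring
    _ ≤ 4 * (C * D) * J := by gcongr
    _ = 4 * (D / 2) * (2 * C * J) := by ring
    _ ≤ (D / 2 + 2 * C * J) ^ 2 := four_mul_le_sq_add _ _

lemma starNorm_sq_le (hΩ : IsDecomposition Ω₁ Ω₂) {C : ℝ} (hv : v ∈ M.velocitySpace k)
    (htrace : M.interfaceNormSq (-1 / 2) (M.meanFlux v) ≤ C * dirichletForm Ω₂ v.2 v.2) :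
    M.starNorm v ^ 2 ≤ dirichletForm Ω₁ v.1 v.1 + (3 + C) * dirichletForm Ω₂ v.2 v.2 +
      2 * M.s v v + M.interfaceNormSq (1 / 2) (jump v) := by
  rw [starNorm_sq hΩ hv]
  linarith [dirichletForm_region_T₁star_le hv hΩ]

theorem le_a_add_s (hd : 1 ≤ d) (hΩ : IsDecomposition Ω₁ Ω₂) {C γ : ℝ} (hC : 0 ≤ C)
    (hγ : 2 * C + 1 ≤ γ) (hv : v ∈ M.velocitySpace k)
    (htrace : M.interfaceNormSq (-1 / 2) (M.meanFlux v) ≤ C * dirichletForm Ω₂ v.2 v.2) :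
    (6 + 2 * C)⁻¹ * M.starNorm v ^ 2 ≤ M.a γ v v + M.s v v := by
  rw [inv_mul_le_iff₀ (by positivity)]
  set D₁ := dirichletForm Ω₁ v.1 v.1
  set D₂ := dirichletForm Ω₂ v.2 v.2
  set J := M.interfaceNormSq (1 / 2) (jump v)
  have hD₁ : 0 ≤ D₁ := dirichletForm_self_nonneg _ _
  have hs : 0 ≤ M.s v v := dirichletForm_self_nonneg _ _
  have hJ : 0 ≤ J := M.interfaceNormSq_nonneg _ _
  have hlower : D₁ + D₂ / 2 + M.s v v + J ≤ M.a γ v v + M.s v v := by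
    have hflux := two_mul_abs_interfaceInner_meanFlux_jump_le hd hΩ.isOpen₁ hΩ.isOpen₂ hC hv htrace
    have hpenalty : (2 * C + 1) * J ≤ γ * J := by gcongr
    rw [a, interfaceInner_inv_meshSize_smul_self]
    linarith [le_abs_self (M.interfaceInner (M.meanFlux v) (jump v))]
  calc M.starNorm v ^ 2 ≤ D₁ + (3 + C) * D₂ + 2 * M.s v v + J := starNorm_sq_le hΩ hv htrace
    _ ≤ (6 + 2 * C) * (D₁ + D₂ / 2 + M.s v v + J) := by
        nlinarith [mul_nonneg hC hD₁, mul_nonneg hC hs, mul_nonneg hC hJ]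
    _ ≤ (6 + 2 * C) * (M.a γ v v + M.s v v) := by gcongr

end Nitsche

end OverlappingMeshes

end OverlapNitsche

theorem mainTheorem5_general (d : ℕ) (hd : 1 ≤ d) (k : ℕ) (σ : ℝ) (hσ : 0 < σ) :
    ∃ γ₀ : ℝ, 0 < γ₀ ∧ ∀ γ : ℝ, γ₀ ≤ γ → ∃ c C : ℝ, 0 < c ∧ 0 < C ∧
      ∀ Ω₁ Ω₂ : Set (OverlapNitsche.Space d), OverlapNitsche.IsDecomposition Ω₁ Ω₂ →
        ∀ M : OverlapNitsche.OverlappingMeshes Ω₁ Ω₂, M.T₂.ShapeRegular σ →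
          (∀ u ∈ M.velocitySpace k, ∀ v ∈ M.velocitySpace k,
            M.a γ u v + M.s u v ≤ C * M.starNorm u * M.starNorm v) ∧
          (∀ v ∈ M.velocitySpace k, c * M.starNorm v ^ 2 ≤ M.a γ v v + M.s v v) := by
  obtain ⟨C, hC, htrace⟩ :=
    OverlapNitsche.OverlappingMeshes.exists_interfaceNormSq_meanFlux_le d k hd hσ
  refine ⟨2 * C + 1, by positivity, fun γ hγ => ⟨(6 + 2 * C)⁻¹, 6 + γ, by positivity, by linarith,
    fun Ω₁ Ω₂ hΩ M hM => ⟨fun u hu v hv => ?_, fun v hv => ?_⟩⟩⟩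
  · exact OverlapNitsche.OverlappingMeshes.a_add_s_le hd hΩ (by linarith) hu hv
  · exact OverlapNitsche.OverlappingMeshes.le_a_add_s hd hΩ hC.le hγ hv (htrace Ω₁ Ω₂ hΩ M hM v hv)

theorem mainTheorem5 (d : ℕ) (hd : d = 2 ∨ d = 3) (k : ℕ) (σ : ℝ) (hσ : 0 < σ) :
    ∃ γ₀ : ℝ, 0 < γ₀ ∧ ∀ γ : ℝ, γ₀ ≤ γ →
      ∀ Ω₁ Ω₂ : Set (OverlapNitsche.Space d), OverlapNitsche.IsDecomposition Ω₁ Ω₂ →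
        ∃ c C : ℝ, 0 < c ∧ 0 < C ∧
          ∀ M : OverlapNitsche.OverlappingMeshes Ω₁ Ω₂,
            M.T₀.ShapeRegular σ → M.T₂.ShapeRegular σ →
              (∀ u ∈ M.velocitySpace k, ∀ v ∈ M.velocitySpace k,
                M.a γ u v + M.s u v ≤ C * M.starNorm u * M.starNorm v) ∧
              (∀ v ∈ M.velocitySpace k,
                c * M.starNorm v ^ 2 ≤ M.a γ v v + M.s v v) := by
  obtain ⟨γ₀, hγ₀, h⟩ := mainTheorem5_general d (by omega) k σ hσ
  exact ⟨γ₀, hγ₀, fun γ hγ Ω₁ Ω₂ hΩ => let ⟨c, C, hc, hC, hM⟩ := h γ hγ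
    ⟨c, C, hc, hC, fun M _ => hM Ω₁ Ω₂ hΩ M⟩⟩
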